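/- Let $K$ be a field and let $2\le p\le c\le q$ be integers. Let $H$ be the graph on $c$ vertices that is the disjoint union of a complete graph on $c-(p-1)$ vertices and $p-1$ isolated vertices. Let $K_{q-c}*H$ be the join of the complete graph on $q-c$ vertices with $H$ (the disjoint union together with all edges between the two parts), and let $G=G_{p,c,q}$ be the graph obtained from $K_{q-c}*H$ by attaching to every vertex $v$ one new vertex (a whisker) that is adjacent to $v$ only. Let $S$ be the polynomial ring over $K$ whose variables $x_v$ are indexed by the vertices $v$ of $G$. A matching of $G$ is a set of pairwise disjoint edges; it is induced if the subgraph of $G$ induced on the vertices it covers has no edges other than those of the matching. Let $\nu(G)$ and $\nu_1(G)$ be the maximal cardinality of a matching and of an induced matching of $G$. For $1\le k\le \nu(G)$ let $$I(G)^{[k]}=\Big(\prod_{\{i,j\}\in M}x_ix_j \;:\; M \text{ a matching of } G \text{ with } |M|=k\Big)\subset S .$$ A monomial ideal of $S$ generated in one degree has linear quotients if its minimal monomial generators can be ordered $u_1,\dots,u_s$ so that each colon ideal $(u_1,\dots,u_{j-1}):u_j$, $2\le j\le s$, is generated by variables. A graded ideal generated in a single degree $d$ is linearly related if the module of syzygies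 of a minimal system of homogeneous generators is generated by relations whose coefficients are linear forms (or zero); it has a linear resolution if it has a graded free resolution $\cdots\to S(-d-1)^{b_1}\to S(-d)^{b_0}\to I\to 0$ all of whose maps between free modules are given by matrices with linear forms (or zero) as entries. The linearity index $c(G)$ is the smallest $k$ with $1\le k\le\nu(G)$ for which $I(G)^{[k]}$ has a linear resolution. Then: 1. $I(G)^{[k]}$ has linear quotients for every $c\le k\le q$; 2. $I(G)^{[k]}$ is not linearly related for every $1\le k<c$; 3. $\nu_1(G)=p$ and $\nu(G)=q$; 4. $c(G)=c$. -/

import Mathlib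

noncomputable section

/-! ## Graphs -/

/-- The join `G * H`: the disjoint union of `G` and `H` together with all edges between the two. -/
def graphJoin {V W : Type*} (G : SimpleGraph V) (H : SimpleGraph W) : SimpleGraph (V ⊕ W) :=
  (G ⊕g H) ⊔ completeBipartiteGraph V W

/-- The graph obtained from `G` by attaching one new pendant vertex `Sum.inr v` (a whisker) to every
vertex `v` of `G`; the old vertices are the `Sum.inl v`. -/
def whiskerGraph {V : Type*} (G : SimpleGraph V) : SimpleGraph (V ⊕ V) where
  Adj
    | Sum.inl u, Sum.inl v => G.Adj u v
    | Sum.inl u, Sum.inr v => u = v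
    | Sum.inr u, Sum.inl v => u = v
    | Sum.inr _, Sum.inr _ => False
  symm := ⟨by
    rintro (u | u) (v | v) h
    · exact SimpleGraph.Adj.symm h
    · exact Eq.symm h
    · exact Eq.symm h
    · exact h⟩
  loopless := ⟨by
    rintro (u | u) h
    · exact G.loopless.irrefl u h
    · exact h⟩

/-- The graph `H`: disjoint union of a complete graph on `c - (p - 1)` vertices and `p - 1`
isolated vertices. -/
def cliquePlusIsolated (p c : ℕ) : SimpleGraph (Fin (c - (p - 1)) ⊕ Fin (p - 1)) :=
  (⊤ : SimpleGraph (Fin (c - (p - 1)))) ⊕g (⊥ : SimpleGraph (Fin (p - 1)))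

/-- The vertex set of `G_{p,c,q}`. -/
abbrev PCQVertex (p c q : ℕ) : Type :=
  (Fin (q - c) ⊕ (Fin (c - (p - 1)) ⊕ Fin (p - 1))) ⊕
    (Fin (q - c) ⊕ (Fin (c - (p - 1)) ⊕ Fin (p - 1)))

/-- The graph `G_{p,c,q}`: a whisker is attached to every vertex of `K_{q-c} * H`. -/
def pcqGraph (p c q : ℕ) : SimpleGraph (PCQVertex p c q) :=
  whiskerGraph (graphJoin (⊤ : SimpleGraph (Fin (q - c))) (cliquePlusIsolated p c))

/-- A finite set of edges of `G` that are pairwise disjoint. -/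
def IsMatchingSet {V : Type*} (G : SimpleGraph V) (M : Finset (Sym2 V)) : Prop :=
  (∀ e ∈ M, e ∈ G.edgeSet) ∧ ∀ e ∈ M, ∀ f ∈ M, e ≠ f → ∀ v, v ∈ e → v ∉ f

/-- A matching `M` such that the subgraph of `G` induced on the vertices covered by `M` has no
edges other than those of `M`. -/
def IsInducedMatchingSet {V : Type*} (G : SimpleGraph V) (M : Finset (Sym2 V)) : Prop :=
  IsMatchingSet G M ∧
    ∀ e ∈ G.edgeSet, (∀ v ∈ e, ∃ f ∈ M, v ∈ f) → e ∈ M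

/-- The matching number `ν(G)` of a finite graph. -/
def matchingNumber {V : Type*} [Finite V] (G : SimpleGraph V) : ℕ :=
  sSup {n | ∃ M : Finset (Sym2 V), IsMatchingSet G M ∧ M.card = n}

/-- The induced matching number `ν₁(G)` of a finite graph. -/
def inducedMatchingNumber {V : Type*} [Finite V] (G : SimpleGraph V) : ℕ :=
  sSup {n | ∃ M : Finset (Sym2 V), IsInducedMatchingSet G M ∧ M.card = n}

/-! ## Squarefree powers of edge ideals -/

/-- The monomial `x_e = x_i x_j` of an edge `e = {i, j}`. -/
def edgeMonomial {V : Type*} (K : Type*) [Field K] (e : Sym2 V) : MvPolynomial V K :=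
  Sym2.mul (e.map MvPolynomial.X)

/-- The `k`-th squarefree power `I(G)^{[k]}` of the edge ideal of `G`, in the polynomial ring
over `K` whose variables are the vertices of `G`. -/
def squarefreePower {V : Type*} (K : Type*) [Field K] (G : SimpleGraph V) (k : ℕ) :
    Ideal (MvPolynomial V K) :=
  Ideal.span {f | ∃ M : Finset (Sym2 V), IsMatchingSet G M ∧ M.card = k ∧
    f = ∏ e ∈ M, edgeMonomial K e}

/-! ## Linear quotients, linear relations, linear resolutions -/

/-- The (exponent vectors of the) minimal monomial generators of a monomial ideal `I`: the
monomials of `I` that are not divisible by any other monomial of `I`. -/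
def minimalMonomials {σ K : Type*} [Field K] (I : Ideal (MvPolynomial σ K)) : Set (σ →₀ ℕ) :=
  {a | MvPolynomial.monomial a (1 : K) ∈ I ∧
    ∀ b : σ →₀ ℕ, b ≤ a → MvPolynomial.monomial b (1 : K) ∈ I → b = a}

/-- The monomial ideal `I` is generated in one degree and its minimal monomial generators can be
listed as `u_0, u_1, …` in such a way that every colon ideal `(u_0, …, u_{j-1}) : u_j` with
`1 ≤ j` is generated by variables. -/
def HasLinearQuotients {σ K : Type*} [Field K] (I : Ideal (MvPolynomial σ K)) : Prop :=
  I = Ideal.span {f | ∃ a ∈ minimalMonomials I, f = MvPolynomial.monomial a (1 : K)} ∧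
  (∃ d : ℕ, ∀ a ∈ minimalMonomials I, a.degree = d) ∧
  ∃ l : List (σ →₀ ℕ), l.Nodup ∧ (∀ a, a ∈ l ↔ a ∈ minimalMonomials I) ∧
    ∀ (j : ℕ) (hj : j < l.length), 1 ≤ j →
      ∃ T : Set σ,
        (Ideal.span {f | ∃ a ∈ l.take j, f = MvPolynomial.monomial a (1 : K)}).colon
            {MvPolynomial.monomial l[j] (1 : K)} =
          Ideal.span ((MvPolynomial.X : σ → MvPolynomial σ K) '' T)

/-- The module of relations `{r | ∑ i, r i * f i = 0}` between the polynomials `f 0, …, f (m-1)`. -/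
def syzygies {σ K : Type*} [Field K] {m : ℕ} (f : Fin m → MvPolynomial σ K) :
    Submodule (MvPolynomial σ K) (Fin m → MvPolynomial σ K) :=
  LinearMap.ker (Fintype.linearCombination (MvPolynomial σ K) f)

/-- The ideal `I` is generated in a single degree `d` and linearly related: for a minimal system
of generators consisting of forms of degree `d`, the first syzygy module is generated by linear
relations, i.e. by relations all of whose coefficients are linear forms (or zero). (Two such
systems differ by an invertible matrix over `K`, so the choice of the system is immaterial.) -/
def IsLinearlyRelated {σ K : Type*} [Field K] (I : Ideal (MvPolynomial σ K)) : Prop :=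
  ∃ (d m : ℕ) (f : Fin m → MvPolynomial σ K),
    (∀ i, (f i).IsHomogeneous d) ∧
    Ideal.span (Set.range f) = I ∧
    (∀ i, f i ∉ Ideal.span (f '' {i}ᶜ)) ∧
    Submodule.span (MvPolynomial σ K) {r | r ∈ syzygies f ∧ ∀ i, (r i).IsHomogeneous 1} =
      syzygies f

/-- The ideal `I` has a linear resolution: there are a degree `d` and an exact complex of free
modules `⋯ → S(-d-2)^{b 2} → S(-d-1)^{b 1} → S(-d)^{b 0} → I → 0`, where the last map is given by
forms `f` of degree `d` and all the other maps by matrices `A i` of linear forms. (Such a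
resolution is automatically minimal.) -/
def HasLinearResolution {σ K : Type*} [Field K] (I : Ideal (MvPolynomial σ K)) : Prop :=
  ∃ (d : ℕ) (b : ℕ → ℕ) (f : Fin (b 0) → MvPolynomial σ K)
    (A : ∀ i, Matrix (Fin (b i)) (Fin (b (i + 1))) (MvPolynomial σ K)),
    (∀ j, (f j).IsHomogeneous d) ∧
    (∀ i r s, (A i r s).IsHomogeneous 1) ∧
    Ideal.span (Set.range f) = I ∧
    LinearMap.range (A 0).mulVecLin = syzygies f ∧
    ∀ i, LinearMap.range (A (i + 1)).mulVecLin = LinearMap.ker (A i).mulVecLin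

/-- The linearity index `c(G)`: the smallest `k` with `1 ≤ k ≤ ν(G)` such that `I(G)^{[k]}` has a
linear resolution. -/
def linearityIndex {V : Type*} [Finite V] (K : Type*) [Field K] (G : SimpleGraph V) : ℕ :=
  sInf {k | 1 ≤ k ∧ k ≤ matchingNumber G ∧ HasLinearResolution (squarefreePower K G k)}

end

/-! ### Submodules with linear resolutions, and the horseshoe lemma. -/

noncomputable section

open MvPolynomial

variable {σ K : Type*} [Field K]

/-! Let `A` be the set of vertices of `K_{q-c}` (the hubs) and `D` the set of isolated vertices of
`H`. A leaf of a whisker can only be matched to its base vertex, so the vertex set covered by a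
matching is recorded by the function `m` that counts, for each base vertex, how many of that vertex
and its leaf are missing. The functions arising from `k`-matchings are those with values at most 2,
total `2(q-k)`, and no more ones on `D` than on `A`: a base vertex covered without its leaf is
matched inside the base, and a vertex of `D` has only hubs as base neighbours
(`MatchCover.exists_isState`, `IsState.matchCover`).

For `k ≥ c` the total is at most `2|A|`, so there is room to push the missing vertices onto the
hubs. The generators are ordered by decreasing total on `A`, then number of ones on `A`, then an
injective weight on `A`. Whenever `r` is not below `m` in this order, one unit can be moved in `m`
from a place where `m` exceeds `r` to another place, staying among the admissible functions and
strictly raising the key (`exists_transfer`). This is the exchange property that makes all colon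
ideals generated by variables (`hasLinearQuotients_of_key`). An iterated extension of syzygy modules
turns linear quotients into a linear resolution (`HasLinearQuotients.hasLinearResolution`).

For `k < c`, take an isolated vertex `d` of `H` and `k` of the other `c-1` vertices of `H`. None of
these is adjacent to `d`, so replacing one of their whiskers by the whisker at `d` is a quadratic
relation that linear ones cannot produce (`span_linear_ne_syzygies`). That obstruction applies to
every homogeneous generating system of one degree, minimal or not, and thus excludes linear
relations and linear resolutions alike.

For the invariants, the whiskers form a perfect matching, and induced matchings correspond in size
to independent sets of the base graph. -/

theorem homogeneousComponent_add_mul {a : MvPolynomial σ K} {d : ℕ} (ha : a.IsHomogeneous d)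
    (n : ℕ) (f : MvPolynomial σ K) :
    homogeneousComponent (d + n) (a * f) = a * homogeneousComponent n f := by
  let := MvPolynomial.gradedAlgebra (σ := σ) (R := K)
  have := DirectSum.coe_decompose_mul_add_of_left_mem (homogeneousSubmodule σ K)
    (i := d) (j := n) (a := a) (b := f) ha
  have key : ∀ (m : ℕ) (p : MvPolynomial σ K),
      (DirectSum.decompose (homogeneousSubmodule σ K) p m : MvPolynomial σ K) =
        homogeneousComponent m p := fun m p => decomposition.decompose'_apply p m
  rwa [key, key] at this

/-- A submodule of a free module that is closed under taking homogeneous components, all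
basis vectors having the same degree. -/
def IsGradedSubmodule {ι : Type} (N : Submodule (MvPolynomial σ K) (ι → MvPolynomial σ K)) : Prop :=
  ∀ x ∈ N, ∀ n : ℕ, (fun i => homogeneousComponent n (x i)) ∈ N

theorem isGradedSubmodule_ker_mulVecLin {ι κ : Type} [Fintype κ]
    (A : Matrix ι κ (MvPolynomial σ K)) {d : ℕ} (hA : ∀ i j, (A i j).IsHomogeneous d) :
    IsGradedSubmodule (LinearMap.ker A.mulVecLin) := by
  intro x hx n
  simp only [LinearMap.mem_ker, Matrix.mulVecLin_apply] at hx ⊢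
  ext1 i
  have h := congrArg (homogeneousComponent (d + n)) (congrFun hx i)
  simpa [Matrix.mulVec, dotProduct, map_sum, homogeneousComponent_add_mul (hA i _)] using h

/-- The submodule `N` of a free module admits a (possibly infinite) linear resolution: it is the
image of a matrix of linear forms whose kernel again has this property, and so on. -/
def LinRes {ι : Type} (N : Submodule (MvPolynomial σ K) (ι → MvPolynomial σ K)) : Prop :=
  ∃ P : ∀ ι : Type, Submodule (MvPolynomial σ K) (ι → MvPolynomial σ K) → Prop,
    P ι N ∧ ∀ (ι : Type) (N : Submodule (MvPolynomial σ K) (ι → MvPolynomial σ K)), P ι N →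
      ∃ (κ : Type) (_ : Fintype κ) (A : Matrix ι κ (MvPolynomial σ K)),
        (∀ i j, (A i j).IsHomogeneous 1) ∧ LinearMap.range A.mulVecLin = N ∧
          P κ (LinearMap.ker A.mulVecLin)

theorem LinRes.exists_matrix {ι : Type}
    {N : Submodule (MvPolynomial σ K) (ι → MvPolynomial σ K)} (h : LinRes N) :
    ∃ (κ : Type) (_ : Fintype κ) (A : Matrix ι κ (MvPolynomial σ K)),
      (∀ i j, (A i j).IsHomogeneous 1) ∧ LinearMap.range A.mulVecLin = N ∧
        LinRes (LinearMap.ker A.mulVecLin) := by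
  obtain ⟨P, hN, hP⟩ := h
  obtain ⟨κ, _, A, h1, h2, h3⟩ := hP ι N hN
  exact ⟨κ, _, A, h1, h2, P, h3, hP⟩

/-- `LinRes` is a greatest fixed point, witnessed by an invariant `P`. Prepending one matrix only
requires enlarging the invariant by the new module. -/
theorem LinRes.of_matrix {ι κ : Type} [Fintype κ]
    {N : Submodule (MvPolynomial σ K) (ι → MvPolynomial σ K)}
    (A : Matrix ι κ (MvPolynomial σ K)) (hA : ∀ i j, (A i j).IsHomogeneous 1)
    (hN : LinearMap.range A.mulVecLin = N) (h : LinRes (LinearMap.ker A.mulVecLin)) :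
    LinRes N := by
  refine ⟨fun ι N => LinRes N ∨ ∃ (κ : Type) (_ : Fintype κ) (A : Matrix ι κ (MvPolynomial σ K)),
        (∀ i j, (A i j).IsHomogeneous 1) ∧ LinearMap.range A.mulVecLin = N ∧
          LinRes (LinearMap.ker A.mulVecLin), Or.inr ⟨κ, _, A, hA, hN, h⟩, ?_⟩
  rintro ι N (h | ⟨κ, _, A, h1, h2, h3⟩)
  · obtain ⟨κ, _, A, h1, h2, h3⟩ := h.exists_matrix
    exact ⟨κ, _, A, h1, h2, Or.inl h3⟩
  · exact ⟨κ, _, A, h1, h2, Or.inl h3⟩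

theorem LinRes.bot {ι : Type} : LinRes (⊥ : Submodule (MvPolynomial σ K) (ι → MvPolynomial σ K)) := by
  refine ⟨fun _ N => N = ⊥, rfl, ?_⟩
  rintro ι N rfl
  refine ⟨Empty, inferInstance, Matrix.of fun _ => Empty.elim, fun _ j => j.elim, ?_, ?_⟩
  · rw [eq_bot_iff]
    rintro _ ⟨y, rfl⟩
    have : y = 0 := Subsingleton.elim _ _
    simp [this]
  · exact Subsingleton.elim _ _

theorem LinRes.reindex {ι κ : Type} (e : ι ≃ κ)
    {N : Submodule (MvPolynomial σ K) (ι → MvPolynomial σ K)} (h : LinRes N) :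
    LinRes (N.map (LinearMap.funLeft (MvPolynomial σ K) (MvPolynomial σ K) e.symm)) := by
  obtain ⟨μ, _, A, h1, h2, h3⟩ := h.exists_matrix
  have hA : (A.submatrix e.symm id).mulVecLin =
      (LinearMap.funLeft (MvPolynomial σ K) (MvPolynomial σ K) e.symm).comp A.mulVecLin := by
    ext x i; simp [Matrix.mulVec, dotProduct, LinearMap.funLeft]
  refine .of_matrix (A.submatrix e.symm id) (fun i j => h1 _ _) ?_ ?_
  · rw [hA, LinearMap.range_comp, h2]
  · rw [hA, LinearMap.ker_comp, LinearMap.ker_eq_bot.2, ← LinearMap.ker]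
    · exact h3
    · exact LinearMap.funLeft_injective_of_surjective _ _ _ e.symm.surjective

/-- The extension argument produces sums of index types, while `HasLinearResolution` asks for `Fin`;
this converts one step of the resolution. -/
theorem LinRes.exists_fin_matrix {ι : Type}
    {N : Submodule (MvPolynomial σ K) (ι → MvPolynomial σ K)} (h : LinRes N) :
    ∃ (b : ℕ) (A : Matrix ι (Fin b) (MvPolynomial σ K)),
      (∀ i j, (A i j).IsHomogeneous 1) ∧ LinearMap.range A.mulVecLin = N ∧
        LinRes (LinearMap.ker A.mulVecLin) := by
  obtain ⟨κ, _, A, h1, h2, h3⟩ := h.exists_matrix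
  let e := Fintype.equivFin κ
  have hA : (A.submatrix id e.symm).mulVecLin =
      A.mulVecLin.comp (LinearMap.funLeft (MvPolynomial σ K) (MvPolynomial σ K) e) := by
    ext x i
    simp only [Matrix.mulVecLin_apply, LinearMap.coe_comp, Function.comp_apply, Matrix.mulVec,
      dotProduct, LinearMap.funLeft, LinearMap.coe_mk, AddHom.coe_mk, Matrix.submatrix_apply, id]
    rw [← e.symm.sum_comp (fun j => A i j * _)]
    simp
  refine ⟨Fintype.card κ, A.submatrix id e.symm, fun i j => h1 _ _, ?_, ?_⟩
  · rw [hA, LinearMap.range_comp, LinearMap.range_eq_top.2, ← LinearMap.range_eq_map, h2]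
    exact LinearMap.funLeft_surjective_of_injective _ _ _ e.injective
  · convert h3.reindex e using 1
    rw [hA, LinearMap.ker_comp]
    ext x
    simp only [Submodule.mem_comap, Submodule.mem_map]
    constructor
    · intro hx
      exact ⟨_, hx, by ext i; simp [LinearMap.funLeft]⟩
    · rintro ⟨y, hy, rfl⟩
      convert hy using 1
      ext i; simp [LinearMap.funLeft]

/-- The horseshoe lemma: an extension of submodules with linear resolutions has a linear
resolution. -/
theorem LinRes.extension {ι ι₁ ι₂ : Type} (e : ι ≃ ι₁ ⊕ ι₂)
    {N : Submodule (MvPolynomial σ K) (ι → MvPolynomial σ K)}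
    {N₁ : Submodule (MvPolynomial σ K) (ι₁ → MvPolynomial σ K)}
    {N₂ : Submodule (MvPolynomial σ K) (ι₂ → MvPolynomial σ K)}
    (hN : IsGradedSubmodule N) (h₁ : LinRes N₁) (h₂ : LinRes N₂)
    (hN₁ : ∀ x, x ∈ N₁ ↔ Sum.elim x 0 ∘ e ∈ N)
    (hN₂ : ∀ y, y ∈ N₂ ↔ ∃ x, Sum.elim x y ∘ e ∈ N) : LinRes N := by
  refine ⟨fun ι N => ∃ (ι₁ ι₂ : Type) (e : ι ≃ ι₁ ⊕ ι₂)
    (N₁ : Submodule (MvPolynomial σ K) (ι₁ → MvPolynomial σ K))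
    (N₂ : Submodule (MvPolynomial σ K) (ι₂ → MvPolynomial σ K)), IsGradedSubmodule N ∧
    LinRes N₁ ∧ LinRes N₂ ∧ (∀ x, x ∈ N₁ ↔ Sum.elim x 0 ∘ e ∈ N) ∧
    (∀ y, y ∈ N₂ ↔ ∃ x, Sum.elim x y ∘ e ∈ N), ⟨ι₁, ι₂, e, N₁, N₂, hN, h₁, h₂, hN₁, hN₂⟩, ?_⟩
  clear hN hN₁ hN₂ h₁ h₂ N N₁ N₂ e ι ι₁ ι₂
  rintro ι N ⟨ι₁, ι₂, e, N₁, N₂, hN, h₁, h₂, hN₁, hN₂⟩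
  obtain ⟨κ₁, _, A₁, hA₁, hr₁, hk₁⟩ := h₁.exists_matrix
  obtain ⟨κ₂, _, A₂, hA₂, hr₂, hk₂⟩ := h₂.exists_matrix
  classical
  -- Each column of `A₂` lifts to `N`. Since `N` is graded, the degree-one component of a lift is
  -- again a lift, which keeps the block matrix linear.
  have hlift : ∀ j : κ₂, ∃ x : ι₁ → MvPolynomial σ K, (∀ i, (x i).IsHomogeneous 1) ∧
      Sum.elim x (fun i => A₂ i j) ∘ e ∈ N := by
    intro j
    have hj : (fun i => A₂ i j) ∈ N₂ := by
      rw [← hr₂]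
      exact ⟨Pi.single j 1, by ext1 i; simp⟩
    obtain ⟨x, hx⟩ := (hN₂ _).1 hj
    refine ⟨fun i => homogeneousComponent 1 (x i), fun i => homogeneousComponent_isHomogeneous _ _,
      ?_⟩
    convert hN _ hx 1 using 1
    ext1 i
    rcases h : e i with a | a
    · simp [h]
    · simp [h, homogeneousComponent_eq_self (hA₂ a j)]
  choose B hB hBN using hlift
  let A' : Matrix (ι₁ ⊕ ι₂) (κ₁ ⊕ κ₂) (MvPolynomial σ K) :=
    Matrix.fromBlocks A₁ (Matrix.of fun i j => B j i) 0 A₂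
  let A : Matrix ι (κ₁ ⊕ κ₂) (MvPolynomial σ K) := A'.submatrix e id
  have hA : ∀ i j, (A i j).IsHomogeneous 1 := by
    intro i j
    rcases h : e i with a | a <;> rcases j with j | j
    · simpa [A, A', h] using hA₁ a j
    · simpa [A, A', h] using hB j a
    · simpa [A, A', h] using isHomogeneous_zero σ K 1
    · simpa [A, A', h] using hA₂ a j
  have hmul : ∀ x y, A.mulVec (Sum.elim x y) =
      Sum.elim (A₁.mulVec x + (Matrix.of fun i j => B j i).mulVec y) (A₂.mulVec y) ∘ e := by
    intro x y
    have : A.mulVec (Sum.elim x y) = A'.mulVec (Sum.elim x y) ∘ e := rfl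
    rw [this, Matrix.fromBlocks_mulVec]
    simp
  have hB' : ∀ y, Sum.elim ((Matrix.of fun i j => B j i).mulVec y) (A₂.mulVec y) ∘ e ∈ N := by
    intro y
    have : Sum.elim ((Matrix.of fun i j => B j i).mulVec y) (A₂.mulVec y) ∘ e =
        ∑ j, y j • (Sum.elim (B j) (fun i => A₂ i j) ∘ e) := by
      ext1 i
      rcases h : e i with a | a <;>
        simp [h, Matrix.mulVec, dotProduct, mul_comm]
    rw [this]
    exact N.sum_mem fun j _ => N.smul_mem _ (hBN j)
  have hA₁N : ∀ x, Sum.elim (A₁.mulVec x) 0 ∘ e ∈ N := fun x =>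
    (hN₁ _).1 (hr₁ ▸ ⟨x, rfl⟩)
  have elim_add : ∀ (x x' : ι₁ → MvPolynomial σ K) (y y' : ι₂ → MvPolynomial σ K),
      Sum.elim (x + x') (y + y') ∘ e = Sum.elim x y ∘ e + Sum.elim x' y' ∘ e := by
    intro x x' y y'
    ext1 i
    rcases h : e i with a | a <;> simp [h]
  -- The kernel of the block triangular matrix is itself an extension of `ker A₂` by `ker A₁`, so
  -- the coinductive invariant is preserved.
  refine ⟨κ₁ ⊕ κ₂, inferInstance, A, hA, ?_, κ₁, κ₂, Equiv.refl _, _, _,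
    isGradedSubmodule_ker_mulVecLin A hA, hk₁, hk₂, ?_, ?_⟩
  · apply le_antisymm
    · rintro _ ⟨z, rfl⟩
      rw [Matrix.mulVecLin_apply, ← Sum.elim_comp_inl_inr z, hmul]
      have := N.add_mem (hA₁N (z ∘ Sum.inl)) (hB' (z ∘ Sum.inr))
      rwa [← elim_add, zero_add] at this
    · intro z hz
      have hz' : z = Sum.elim (z ∘ e.symm ∘ Sum.inl) (z ∘ e.symm ∘ Sum.inr) ∘ e := by
        ext1 i
        rcases h : e i with a | a <;>
          simp only [Function.comp_apply, h, Sum.elim_inl, Sum.elim_inr] <;>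
          rw [← h, e.symm_apply_apply]
      have h2 : z ∘ e.symm ∘ Sum.inr ∈ N₂ := (hN₂ _).2 ⟨_, hz' ▸ hz⟩
      rw [← hr₂] at h2
      obtain ⟨y, hy⟩ := h2
      rw [Matrix.mulVecLin_apply] at hy
      have hd := N.sub_mem hz (hB' y)
      have h1 : z ∘ e.symm ∘ Sum.inl - (Matrix.of fun i j => B j i).mulVec y ∈ N₁ := by
        rw [hN₁]
        convert hd using 1
        conv_rhs => rw [hz', hy]
        ext1 i
        rcases h : e i with a | a <;> simp [h]
      rw [← hr₁] at h1
      obtain ⟨x, hx⟩ := h1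
      refine ⟨Sum.elim x y, ?_⟩
      rw [Matrix.mulVecLin_apply] at hx ⊢
      rw [hmul, hx, hy, sub_add_cancel, ← hz']
  · intro x
    rw [LinearMap.mem_ker, LinearMap.mem_ker, Matrix.mulVecLin_apply, Matrix.mulVecLin_apply,
      Equiv.coe_refl, Function.comp_id, hmul]
    constructor
    · intro h
      ext1 i
      rcases h' : e i with a | a <;> simp [h]
    · intro h
      ext1 a
      simpa using congrFun h (e.symm (Sum.inl a))
  · intro y
    simp only [LinearMap.mem_ker, Matrix.mulVecLin_apply, Equiv.coe_refl, Function.comp_id, hmul]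
    constructor
    · intro h
      have h1 := hB' y
      rw [h, ← hN₁, ← hr₁] at h1
      obtain ⟨x, hx⟩ := h1
      refine ⟨-x, ?_⟩
      rw [Matrix.mulVecLin_apply] at hx
      rw [Matrix.mulVec_neg, hx, h, neg_add_cancel]
      ext1 i
      rcases h' : e i with a | a <;> simp
    · rintro ⟨x, hx⟩
      ext1 a
      simpa using congrFun hx (e.symm (Sum.inr a))

end

/-! ### From linear quotients to a linear resolution. -/

noncomputable section

open MvPolynomial

variable {σ K : Type*} [Field K]

theorem isGradedSubmodule_ker_linearCombination {ι : Type} [Fintype ι]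
    {f : ι → MvPolynomial σ K} {d : ℕ} (hf : ∀ i, (f i).IsHomogeneous d) :
    IsGradedSubmodule (LinearMap.ker (Fintype.linearCombination (MvPolynomial σ K) f)) := by
  intro x hx n
  simp only [LinearMap.mem_ker, Fintype.linearCombination_apply, smul_eq_mul] at hx ⊢
  have h := congrArg (homogeneousComponent (d + n)) hx
  simpa [map_sum, mul_comm (x _), homogeneousComponent_add_mul (hf _), mul_comm] using h

/-- An ideal, seen as a submodule of a free module of rank one. -/
def idealInFreeModule (J : Ideal (MvPolynomial σ K)) :
    Submodule (MvPolynomial σ K) (Fin 1 → MvPolynomial σ K) :=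
  Submodule.comap (LinearMap.proj 0) J

theorem mem_idealInFreeModule {J : Ideal (MvPolynomial σ K)} {y : Fin 1 → MvPolynomial σ K} :
    y ∈ idealInFreeModule J ↔ y 0 ∈ J :=
  Iff.rfl

/-- If the relations between all but the last of the forms `f` have a linear resolution, and so has
the colon ideal of the last one, then the relations between the `f` have a linear resolution. -/
theorem linRes_ker_linearCombination_succ {n d : ℕ} {f : Fin (n + 1) → MvPolynomial σ K}
    (hf : ∀ i, (f i).IsHomogeneous d) {J : Ideal (MvPolynomial σ K)}
    (hJ : ∀ y, y ∈ J ↔ y * f (Fin.last n) ∈ Ideal.span (Set.range (f ∘ Fin.castSucc)))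
    (h₁ : LinRes (LinearMap.ker (Fintype.linearCombination (MvPolynomial σ K) (f ∘ Fin.castSucc))))
    (h₂ : LinRes (idealInFreeModule J)) :
    LinRes (LinearMap.ker (Fintype.linearCombination (MvPolynomial σ K) f)) := by
  have key : ∀ (x : Fin n → MvPolynomial σ K) (y : Fin 1 → MvPolynomial σ K),
      Fintype.linearCombination (MvPolynomial σ K) f (Sum.elim x y ∘ finSumFinEquiv.symm) =
        Fintype.linearCombination (MvPolynomial σ K) (f ∘ Fin.castSucc) x +
          y 0 * f (Fin.last n) := by
    intro x y
    simp only [Fintype.linearCombination_apply, smul_eq_mul, Function.comp_apply]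
    rw [Fin.sum_univ_castSucc]
    congr 1
    · refine Finset.sum_congr rfl fun i _ => ?_
      rw [show (Fin.castSucc i : Fin (n + 1)) = Fin.castAdd 1 i from rfl,
        finSumFinEquiv_symm_apply_castAdd, Sum.elim_inl]
    · rw [show Fin.last n = Fin.natAdd n (0 : Fin 1) from rfl,
        finSumFinEquiv_symm_apply_natAdd, Sum.elim_inr]
  refine LinRes.extension finSumFinEquiv.symm (isGradedSubmodule_ker_linearCombination hf) h₁ h₂
    ?_ ?_
  · intro x
    rw [LinearMap.mem_ker, LinearMap.mem_ker, key]
    simp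
  · intro y
    simp only [LinearMap.mem_ker, key, mem_idealInFreeModule]
    rw [hJ, ← neg_mem_iff, Ideal.span, ← Fintype.range_linearCombination, LinearMap.mem_range]
    simp only [add_eq_zero_iff_eq_neg]

/-- A variable outside `T` is a nonzerodivisor modulo the variables in `T`: multiplying by it does
not change the other exponents. -/
theorem mul_X_mem_span_X_iff {T : Set σ} {t : σ} (ht : t ∉ T) (y : MvPolynomial σ K) :
    y * X t ∈ Ideal.span (X '' T : Set (MvPolynomial σ K)) ↔
      y ∈ Ideal.span (X '' T : Set (MvPolynomial σ K)) := by
  refine ⟨fun h => ?_, fun h => Ideal.mul_mem_right _ _ h⟩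
  rw [mem_ideal_span_X_image] at h ⊢
  intro m hm
  obtain ⟨i, hi, hmi⟩ := h (m + Finsupp.single t 1) (by
    rw [mem_support_iff, coeff_mul_X]
    exact mem_support_iff.1 hm)
  refine ⟨i, hi, ?_⟩
  have : t ≠ i := fun h => ht (h ▸ hi)
  simpa [Finsupp.single_apply, this] using hmi

/-- Induction on the number of variables, a Koszul complex in disguise: the colon ideal of the last
variable is the ideal of the preceding ones, so the statement for the ideal feeds the next step for
the relations. -/
theorem linRes_variables (n : ℕ) : ∀ v : Fin n → σ, Function.Injective v →
    LinRes (LinearMap.ker (Fintype.linearCombination (MvPolynomial σ K)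
      fun i => (X (v i) : MvPolynomial σ K))) ∧
    LinRes (idealInFreeModule
      (Ideal.span (X '' Set.range v : Set (MvPolynomial σ K)))) := by
  have second : ∀ {n : ℕ} (v : Fin n → σ), LinRes (LinearMap.ker (Fintype.linearCombination
      (MvPolynomial σ K) fun i => (X (v i) : MvPolynomial σ K))) →
    LinRes (idealInFreeModule
      (Ideal.span (X '' Set.range v : Set (MvPolynomial σ K)))) := by
    intro n v h
    let A : Matrix (Fin 1) (Fin n) (MvPolynomial σ K) := Matrix.of fun _ j => X (v j)
    have hA : ∀ x i, A.mulVecLin x i = Fintype.linearCombination (MvPolynomial σ K)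
        (fun i => (X (v i) : MvPolynomial σ K)) x := by
      intro x i
      simp [A, Matrix.mulVec, dotProduct, Fintype.linearCombination_apply, mul_comm]
    refine .of_matrix A (fun i j => isHomogeneous_X _ _) ?_ ?_
    · ext y
      rw [← Set.range_comp, mem_idealInFreeModule, Ideal.span,
        ← Fintype.range_linearCombination, LinearMap.mem_range, LinearMap.mem_range]
      refine exists_congr fun x => ?_
      rw [funext_iff, Fin.forall_fin_one, hA]
      rfl
    · convert h using 1
      ext x
      rw [LinearMap.mem_ker, LinearMap.mem_ker, funext_iff, Fin.forall_fin_one, hA]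
      rfl
  induction n with
  | zero =>
    intro v _
    have h : LinRes (LinearMap.ker (Fintype.linearCombination (MvPolynomial σ K)
        fun i => (X (v i) : MvPolynomial σ K))) := by
      convert LinRes.bot
      exact Subsingleton.elim _ _
    exact ⟨h, second v h⟩
  | succ n ih =>
    intro v hv
    obtain ⟨h₁, h₂⟩ := ih (v ∘ Fin.castSucc) (hv.comp (Fin.castSucc_injective n))
    have h : LinRes (LinearMap.ker (Fintype.linearCombination (MvPolynomial σ K)
        fun i => (X (v i) : MvPolynomial σ K))) := by
      refine linRes_ker_linearCombination_succ (fun i => isHomogeneous_X _ _) (fun y => ?_) h₁ h₂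
      rw [← mul_X_mem_span_X_iff (t := v (Fin.last n)) _ y, ← Set.range_comp]
      · rfl
      · rintro ⟨i, hi⟩
        exact (Fin.castSucc_lt_last i).ne (hv hi)
    exact ⟨h, second v h⟩

theorem linRes_span_X [Finite σ] (T : Set σ) :
    LinRes (idealInFreeModule
      (Ideal.span (X '' T : Set (MvPolynomial σ K)))) := by
  have := Fintype.ofFinite T
  have h := (linRes_variables (K := K) (Fintype.card T)
    (fun i => ((Fintype.equivFin T).symm i : σ))
    (Subtype.val_injective.comp (Equiv.injective _))).2
  have hr : Set.range (fun i => ((Fintype.equivFin T).symm i : σ)) = T := by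
    exact ((Equiv.surjective _).range_comp _).trans Subtype.range_coe
  rwa [hr] at h

/-- The steps of the resolution are chosen once for all modules with `LinRes`; iterating that choice
from the relations of `f` gives the whole infinite complex. -/
theorem hasLinearResolution_of_linRes {n d : ℕ} {f : Fin n → MvPolynomial σ K}
    (hf : ∀ i, (f i).IsHomogeneous d)
    (h : LinRes (LinearMap.ker (Fintype.linearCombination (MvPolynomial σ K) f))) :
    HasLinearResolution (Ideal.span (Set.range f)) := by
  let St := Σ b : ℕ, {N : Submodule (MvPolynomial σ K) (Fin b → MvPolynomial σ K) // LinRes N}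
  choose b A hA hr hk using fun s : St => s.2.2.exists_fin_matrix
  let st : ℕ → St := fun i => Nat.rec ⟨n, _, h⟩
    (fun _ s => ⟨b s, LinearMap.ker (A s).mulVecLin, hk s⟩) i
  exact ⟨d, fun i => (st i).1, f, fun i => A (st i), hf, fun i => hA (st i), rfl,
    hr (st 0), fun i => hr (st (i + 1))⟩

theorem HasLinearQuotients.hasLinearResolution [Finite σ] {I : Ideal (MvPolynomial σ K)}
    (h : HasLinearQuotients I) : HasLinearResolution I := by
  obtain ⟨hI, ⟨d, hd⟩, l, -, hl, hT⟩ := h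
  have hom : ∀ (j : ℕ) (hj : j < l.length), (monomial l[j] (1 : K)).IsHomogeneous d := fun j hj =>
    isHomogeneous_monomial _ (hd _ ((hl _).1 (List.getElem_mem hj)))
  have hspan : ∀ (j : ℕ) (hj : j ≤ l.length), {f | ∃ a ∈ l.take j, f = monomial a (1 : K)} =
      Set.range (fun i : Fin j => monomial l[i] (1 : K)) := by
    intro j hj
    ext f
    constructor
    · rintro ⟨a, ha, rfl⟩
      obtain ⟨i, hi, rfl⟩ := List.mem_take_iff_getElem.1 ha
      exact ⟨⟨i, by omega⟩, rfl⟩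
    · rintro ⟨i, rfl⟩
      exact ⟨_, List.mem_take_iff_getElem.2 ⟨i, by omega, rfl⟩, rfl⟩
  have main : ∀ (j : ℕ) (hj : j ≤ l.length), LinRes (LinearMap.ker (Fintype.linearCombination
      (MvPolynomial σ K) fun i : Fin j => monomial l[i] (1 : K))) := by
    intro j
    induction j with
    | zero =>
      intro _
      convert LinRes.bot
      exact Subsingleton.elim _ _
    | succ j ih =>
      intro hj
      have hex : ∃ T : Set σ, ∀ y, y ∈ Ideal.span (X '' T : Set (MvPolynomial σ K)) ↔
          y * monomial (l[j]) (1 : K) ∈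
            Ideal.span (Set.range (fun i : Fin j => monomial l[i] (1 : K))) := by
        -- `HasLinearQuotients` says nothing about the first generator; its colon ideal is zero,
        -- generated by the empty set of variables.
        rcases Nat.eq_zero_or_pos j with rfl | hj0
        · refine ⟨∅, fun y => ?_⟩
          simp
        · obtain ⟨T, hT⟩ := hT j (by omega) hj0
          refine ⟨T, fun y => ?_⟩
          rw [← hT, hspan j (by omega), Submodule.mem_colon_singleton, smul_eq_mul]
      obtain ⟨T, hT⟩ := hex
      exact linRes_ker_linearCombination_succ (fun i => hom _ _) hT (ih (by omega))
        (linRes_span_X T)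
  have hall := hspan l.length le_rfl
  rw [hI, show {f | ∃ a ∈ minimalMonomials I, f = monomial a (1 : K)} = _ by
    simpa [hl] using hall]
  exact hasLinearResolution_of_linRes (fun i => hom _ _) (main l.length le_rfl)

end

/-! ### A combinatorial criterion for linear quotients. -/

noncomputable section

open MvPolynomial

variable {σ K : Type*} [Field K]

/-- Distinct monomials of equal degree do not divide each other, so none of the given generators is
redundant. -/
theorem minimalMonomials_span {d : ℕ} {s : Set (σ →₀ ℕ)} (hs : ∀ a ∈ s, a.degree = d) :
    minimalMonomials (Ideal.span ((fun a => monomial a (1 : K)) '' s)) = s := by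
  classical
  have hmem : ∀ a : σ →₀ ℕ, monomial a (1 : K) ∈
      Ideal.span ((fun a => monomial a (1 : K)) '' s) ↔ ∃ b ∈ s, b ≤ a := by
    intro a
    rw [mem_ideal_span_monomial_image, support_monomial, if_neg one_ne_zero]
    simp
  have hle : ∀ a ∈ s, ∀ b ∈ s, b ≤ a → b = a := by
    intro a ha b hb hba
    obtain ⟨c, rfl⟩ := exists_add_of_le hba
    have := hs _ ha
    rw [map_add, hs _ hb] at this
    have hc : c.degree = 0 := by omega
    rw [Finsupp.degree_eq_zero_iff] at hc
    simp [hc]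
  ext a
  simp only [minimalMonomials, hmem, Set.mem_ofPred_eq]
  constructor
  · rintro ⟨⟨b, hb, hba⟩, h⟩
    exact h b hba ⟨b, hb, le_rfl⟩ ▸ hb
  · intro ha
    refine ⟨⟨a, ha, le_rfl⟩, ?_⟩
    rintro b hba ⟨c, hc, hcb⟩
    have := hle a ha c hc (hcb.trans hba)
    exact le_antisymm hba (this ▸ hcb)

/-- A criterion for linear quotients: the generators are indexed by the elements of a finite
set `s` and listed by decreasing `key`. -/
theorem hasLinearQuotients_of_key {ι κ : Type*} [LinearOrder κ] {d : ℕ} (s : Finset ι)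
    (E : ι → σ →₀ ℕ) (key : ι → κ) (hE : ∀ m ∈ s, ∀ r ∈ s, E m = E r → m = r)
    (hd : ∀ m ∈ s, (E m).degree = d)
    (hkey : ∀ m ∈ s, ∀ r ∈ s, r ≠ m → key m ≤ key r → ∃ m' ∈ s, key m < key m' ∧
      ∃ x, E m' ≤ E m + Finsupp.single x 1 ∧ E m x < E r x) :
    HasLinearQuotients (Ideal.span ((fun m => monomial (E m) (1 : K)) '' (s : Set ι))) := by
  classical
  have himg : (fun m => monomial (E m) (1 : K)) '' (s : Set ι) =
      (fun a => monomial a (1 : K)) '' (E '' (s : Set ι)) := by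
    rw [Set.image_image]
  have hmin := minimalMonomials_span (K := K) (d := d) (s := E '' (s : Set ι)) (by
    rintro _ ⟨m, hm, rfl⟩
    exact hd m hm)
  rw [himg]
  set I := Ideal.span ((fun a => monomial a (1 : K)) '' (E '' (s : Set ι))) with hI
  let rel : ι → ι → Prop := fun a b => key b ≤ key a
  have : Std.Total rel := ⟨fun a b => le_total _ _⟩
  have : IsTrans ι rel := ⟨fun a b c h h' => le_trans h' h⟩
  let L : List ι := s.toList.insertionSort rel
  have hLmem : ∀ a, a ∈ L ↔ a ∈ s := fun a => by simp [L]
  have hLnd : L.Nodup := (List.perm_insertionSort _ _).nodup_iff.2 s.nodup_toList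
  have hLs : L.Pairwise rel := List.pairwise_insertionSort _ _
  refine ⟨?_, ⟨d, ?_⟩, L.map E, ?_, ?_, ?_⟩
  · rw [hmin, hI]
    congr 1
    ext f
    simp [eq_comm]
  · rw [hmin]
    rintro _ ⟨m, hm, rfl⟩
    exact hd m hm
  · exact List.Nodup.map_on (fun m hm r hr => hE m ((hLmem m).1 hm) r ((hLmem r).1 hr)) hLnd
  · intro a
    rw [hmin]
    simp [hLmem]
  · intro j hj _
    have hjL : j < L.length := by simpa using hj
    rw [List.getElem_map]
    set m := L[j] with hm
    have hms : m ∈ s := (hLmem m).1 (List.getElem_mem hjL)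
    have hset : {f | ∃ a ∈ (L.map E).take j, f = monomial a (1 : K)} =
        (fun a => monomial a (1 : K)) '' {a | ∃ r ∈ L.take j, a = E r} := by
      ext f
      simp only [← List.map_take, List.mem_map, Set.mem_image, Set.mem_ofPred_eq]
      constructor
      · rintro ⟨a, ⟨r, hr, rfl⟩, rfl⟩
        exact ⟨_, ⟨r, hr, rfl⟩, rfl⟩
      · rintro ⟨a, ⟨r, hr, rfl⟩, rfl⟩
        exact ⟨_, ⟨r, hr, rfl⟩, rfl⟩
    rw [hset]
    refine ⟨{x | ∃ r ∈ L.take j, E r ≤ E m + Finsupp.single x 1}, ?_⟩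
    apply le_antisymm
    · intro f hf
      rw [Submodule.mem_colon_singleton, smul_eq_mul, mem_ideal_span_monomial_image] at hf
      rw [mem_ideal_span_X_image]
      intro a ha
      obtain ⟨_, ⟨r, hr, rfl⟩, hra⟩ := hf (a + E m) (by
        rw [mem_support_iff, coeff_mul_monomial, mul_one]
        exact mem_support_iff.1 ha)
      obtain ⟨i, hi, rfl⟩ := List.mem_take_iff_getElem.1 hr
      have hij : i < j := by omega
      have hiL : i < L.length := by omega
      have hrs : L[i] ∈ s := (hLmem _).1 (List.getElem_mem _)
      have hne : L[i] ≠ m := by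
        intro h
        have := (List.Nodup.getElem_inj_iff hLnd).1 h
        omega
      -- The key of `m'` is strictly larger, so `m'` comes before `m` however the sort breaks ties;
      -- the variable `x` then lies in the colon ideal and divides the given monomial.
      obtain ⟨m', hm', hlt, x, hx, hx'⟩ := hkey m hms _ hrs hne
        (List.pairwise_iff_getElem.1 hLs i j hiL hjL hij)
      refine ⟨x, ⟨m', ?_, hx⟩, ?_⟩
      · obtain ⟨i', hi', rfl⟩ := List.getElem_of_mem ((hLmem m').2 hm')
        refine List.mem_take_iff_getElem.2 ⟨i', ?_, rfl⟩
        by_contra hcon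
        have hji : j ≤ i' := by omega
        rcases hji.eq_or_lt with h | h
        · subst h
          exact lt_irrefl _ hlt
        · exact absurd hlt (not_lt_of_ge (List.pairwise_iff_getElem.1 hLs j i' hjL hi' h))
      · have := hra x
        rw [Finsupp.add_apply] at this
        omega
    · rw [Ideal.span_le]
      rintro _ ⟨x, ⟨r, hr, hrx⟩, rfl⟩
      rw [SetLike.mem_coe, Submodule.mem_colon_singleton, smul_eq_mul,
        mem_ideal_span_monomial_image]
      intro a ha
      refine ⟨E r, ⟨r, hr, rfl⟩, ?_⟩
      rw [X, monomial_mul, one_mul, support_monomial, if_neg one_ne_zero,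
        Finset.mem_singleton] at ha
      rw [ha, add_comm]
      exact hrx

/-! ### The exchange property -/

/-- Lower the value at `v` by one and raise the value at `w` by one. -/
def transfer {β : Type*} [DecidableEq β] (m : β → ℕ) (v w : β) : β → ℕ :=
  fun x => if x = v then m v - 1 else if x = w then m w + 1 else m x

theorem sum_transfer {β : Type*} [Fintype β] [DecidableEq β] (m : β → ℕ) {v w : β} (hvw : v ≠ w)
    (g : β → ℕ → ℤ) :
    ∑ x, g x (transfer m v w x) =
      ∑ x, g x (m x) + (g v (m v - 1) - g v (m v)) + (g w (m w + 1) - g w (m w)) := by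
  have : ∀ x, g x (transfer m v w x) = g x (m x) +
      (if x = v then g v (m v - 1) - g v (m v) else 0) +
      (if x = w then g w (m w + 1) - g w (m w) else 0) := by
    intro x
    unfold transfer
    by_cases h1 : x = v
    · subst h1; simp [hvw]
    · by_cases h2 : x = w
      · subst h2; simp [h1]
      · simp [h1, h2]
  simp [this, Finset.sum_add_distrib]

/-- Otherwise every negative entry has larger weight than every positive one. Shifting the weights
by the largest weight `ω t` of a positive entry changes nothing, as the total is zero, and makes the
weighted sum negative. -/
theorem exists_neg_pos_of_sum_eq_zero {β : Type*} [Fintype β] (d : β → ℤ) (ω : β → ℤ)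
    (h0 : ∑ x, d x = 0) (hω : 0 ≤ ∑ x, ω x * d x) (hne : ∃ x, d x ≠ 0)
    (hinj : ∀ x y, d x ≠ 0 → d y ≠ 0 → ω x = ω y → x = y) :
    ∃ v w, d v < 0 ∧ 0 < d w ∧ ω v < ω w := by
  by_contra! hcon
  obtain ⟨w, hw⟩ : ∃ w, 0 < d w := by
    by_contra! h
    obtain ⟨x, hx⟩ := hne
    exact hx ((Finset.sum_eq_zero_iff_of_nonpos fun i _ => h i).1 h0 x (Finset.mem_univ x))
  obtain ⟨v, hv⟩ : ∃ v, d v < 0 := by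
    by_contra! h
    obtain ⟨x, hx⟩ := hne
    exact hx ((Finset.sum_eq_zero_iff_of_nonneg fun i _ => h i).1 h0 x (Finset.mem_univ x))
  obtain ⟨t, ht, hmax⟩ := Finset.exists_max_image (Finset.univ.filter fun x => 0 < d x) ω
    ⟨w, by simp [hw]⟩
  simp only [Finset.mem_filter, Finset.mem_univ, true_and] at ht hmax
  have hlt : ∀ x, d x < 0 → ω t < ω x := by
    intro x hx
    refine lt_of_le_of_ne (hcon x t hx ht) fun h => ?_
    have := hinj _ _ ht.ne' hx.ne h
    subst this
    omega
  have hsum : ∑ x, (ω x - ω t) * d x < 0 := by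
    refine Finset.sum_neg' (fun x _ => ?_) ⟨v, Finset.mem_univ v, ?_⟩
    · rcases lt_trichotomy (d x) 0 with h | h | h
      · exact mul_nonpos_of_nonneg_of_nonpos (by have := hlt x h; omega) h.le
      · simp [h]
      · exact mul_nonpos_of_nonpos_of_nonneg (by have := hmax x h; omega) h.le
    · exact mul_neg_of_pos_of_neg (by have := hlt v hv; omega) hv
  simp only [sub_mul, Finset.sum_sub_distrib, ← Finset.mul_sum, h0] at hsum
  omega

end

/-! ### The ordering key and its behaviour under transfers. -/

noncomputable section

section Exchange

variable {β : Type*} [Fintype β] (A D : β → Prop) [DecidablePred A]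
  [DecidablePred D] (ω : β → ℤ)

/-- The number of vertices in `A` at which `m` takes the value one. -/
def onesIn (m : β → ℕ) : ℤ := ∑ x, if A x ∧ m x = 1 then 1 else 0

/-- The sum of the values of `m` on `A`. -/
def sumIn (m : β → ℕ) : ℤ := ∑ x, if A x then (m x : ℤ) else 0

/-- The weighted sum of the values of `m` on `A`. -/
def weightIn (m : β → ℕ) : ℤ := ∑ x, if A x then ω x * m x else 0

/-- The generators are ordered by decreasing values of this key. -/
def exchangeKey (m : β → ℕ) : ℤ ×ₗ ℤ ×ₗ ℤ :=
  toLex (sumIn A m, toLex (onesIn A m, weightIn A ω m))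

variable {A D ω}

theorem exchangeKey_lt_iff {m r : β → ℕ} : exchangeKey A ω m < exchangeKey A ω r ↔
    sumIn A m < sumIn A r ∨ sumIn A m = sumIn A r ∧ (onesIn A m < onesIn A r ∨
      onesIn A m = onesIn A r ∧ weightIn A ω m < weightIn A ω r) := by
  simp [exchangeKey, Prod.Lex.toLex_lt_toLex]

theorem exchangeKey_le_iff {m r : β → ℕ} : exchangeKey A ω m ≤ exchangeKey A ω r ↔
    sumIn A m < sumIn A r ∨ sumIn A m = sumIn A r ∧ (onesIn A m < onesIn A r ∨
      onesIn A m = onesIn A r ∧ weightIn A ω m ≤ weightIn A ω r) := by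
  simp [exchangeKey, Prod.Lex.toLex_le_toLex]

variable [DecidableEq β]

theorem onesIn_transfer {m : β → ℕ} {v w : β} (hvw : v ≠ w) :
    onesIn A (transfer m v w) = onesIn A m +
      ((if A v ∧ m v - 1 = 1 then 1 else 0) - (if A v ∧ m v = 1 then 1 else 0)) +
      ((if A w ∧ m w + 1 = 1 then 1 else 0) - (if A w ∧ m w = 1 then 1 else 0)) :=
  sum_transfer m hvw fun x n => if A x ∧ n = 1 then 1 else 0

theorem sumIn_transfer {m : β → ℕ} {v w : β} (hvw : v ≠ w) (hv : 0 < m v) :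
    sumIn A (transfer m v w) = sumIn A m - (if A v then 1 else 0) + (if A w then 1 else 0) := by
  have := sum_transfer m hvw fun x n => if A x then (n : ℤ) else 0
  unfold sumIn
  rw [this]
  push_cast [Nat.cast_sub (Nat.succ_le_of_lt hv)]
  split_ifs <;> ring

theorem weightIn_transfer {m : β → ℕ} {v w : β} (hvw : v ≠ w) (hv : 0 < m v) :
    weightIn A ω (transfer m v w) =
      weightIn A ω m - (if A v then ω v else 0) + (if A w then ω w else 0) := by
  have := sum_transfer m hvw fun x n => if A x then ω x * (n : ℤ) else 0
  unfold weightIn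
  rw [this]
  push_cast [Nat.cast_sub (Nat.succ_le_of_lt hv)]
  split_ifs <;> ring

/-- Exchange when `m` exceeds `r` somewhere outside `A`: move weight onto `A`. -/
theorem exists_transfer_of_lt_outside (hAD : ∀ x, A x → ¬ D x) {m : β → ℕ} (hm : ∀ x, m x ≤ 2)
    (hsum : ∑ x, (m x : ℤ) ≤ 2 * ∑ x, if A x then 1 else 0) (hones : onesIn D m ≤ onesIn A m)
    {v : β} (hvA : ¬ A v) (hv : 0 < m v) :
    ∃ w, v ≠ w ∧ m w < 2 ∧ onesIn D (transfer m v w) ≤ onesIn A (transfer m v w) ∧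
      exchangeKey A ω m < exchangeKey A ω (transfer m v w) := by
  have hkey : ∀ w, A w → v ≠ w → exchangeKey A ω m < exchangeKey A ω (transfer m v w) := by
    intro w hw hvw
    rw [exchangeKey_lt_iff]
    left
    rw [sumIn_transfer hvw hv, if_neg hvA, if_pos hw]
    omega
  have hne : ∀ w, A w → v ≠ w := fun w hw h => hvA (h ▸ hw)
  have hv2 := hm v
  by_cases h0 : ∃ w, A w ∧ m w = 0
  · obtain ⟨w, hw, hw0⟩ := h0
    have hvw := hne w hw
    refine ⟨w, hvw, by omega, ?_, hkey w hw hvw⟩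
    rw [onesIn_transfer hvw, onesIn_transfer hvw]
    simp only [hvA, hw, hAD w hw, hw0, false_and, true_and]
    norm_num
    split_ifs <;> omega
  · push Not at h0
    -- On `A` all values are 1 or 2, so the number of ones there is `2|A|` minus the sum on `A`,
    -- hence at least the sum of `m` outside `A`. The entry at `v` contributes all of `m v` to that
    -- sum, the ones of `D` contribute themselves.
    have hslack : onesIn D m + (m v - if D v ∧ m v = 1 then 1 else 0) ≤ onesIn A m := by
      have hpt : ∀ x, (if D x ∧ m x = 1 then 1 else 0 : ℤ) +
          (if x = v then ((m v : ℤ) - if D v ∧ m v = 1 then 1 else 0) else 0) ≤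
          (if A x ∧ m x = 1 then 1 else 0) + (m x - 2 * if A x then 1 else 0) := by
        intro x
        have hx2 := hm x
        by_cases hxA : A x
        · have := h0 x hxA
          have hxv : x ≠ v := (hne x hxA).symm
          simp only [hxA, hAD x hxA, hxv, false_and, true_and, if_false, if_true]
          split_ifs <;> omega
        · by_cases hxv : x = v
          · subst hxv
            simp only [hxA, false_and, if_false, if_true]
            omega
          · simp only [hxA, hxv, false_and, if_false]
            split_ifs <;> omega
      have := Finset.sum_le_sum fun x (_ : x ∈ Finset.univ) => hpt x
      simp only [Finset.sum_add_distrib, Finset.sum_sub_distrib, ← Finset.mul_sum,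
        Finset.sum_ite_eq', Finset.mem_univ, if_true] at this
      unfold onesIn
      linarith
    obtain ⟨w, hw, hw1⟩ : ∃ w, A w ∧ m w = 1 := by
      by_contra! hcon
      have hA0 : onesIn A m = 0 := Finset.sum_eq_zero fun x _ => by
        rw [if_neg]
        rintro ⟨h, h'⟩
        exact hcon x h h'
      have hD0 : 0 ≤ onesIn D m := Finset.sum_nonneg fun x _ => by split_ifs <;> norm_num
      split_ifs at hslack with h
      · have : 1 ≤ onesIn D m := by
          unfold onesIn
          calc (1 : ℤ) = if D v ∧ m v = 1 then 1 else 0 := by rw [if_pos h]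
            _ ≤ _ := Finset.single_le_sum (f := fun x => if D x ∧ m x = 1 then (1 : ℤ) else 0)
              (fun x _ => by split_ifs <;> norm_num) (Finset.mem_univ v)
        omega
      · omega
    have hvw := hne w hw
    refine ⟨w, hvw, by omega, ?_, hkey w hw hvw⟩
    rw [onesIn_transfer hvw, onesIn_transfer hvw]
    simp only [hvA, hw, hAD w hw, hw1, false_and, true_and]
    norm_num
    split_ifs at hslack ⊢ <;> omega

/-- Exchange when `m` and `r` agree outside `A`: move weight inside `A`. -/
theorem exists_transfer_inside (hAD : ∀ x, A x → ¬ D x)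
    (hω : ∀ x y, A x → A y → ω x = ω y → x = y) {m r : β → ℕ} (hm : ∀ x, m x ≤ 2)
    (hr : ∀ x, r x ≤ 2) (hmr : ∑ x, (m x : ℤ) = ∑ x, (r x : ℤ)) (hones : onesIn D m ≤ onesIn A m)
    (hne : r ≠ m) (hout : ∀ x, ¬ A x → m x = r x)
    (hones' : onesIn A m ≤ onesIn A r)
    (hw : onesIn A m = onesIn A r → weightIn A ω m ≤ weightIn A ω r) :
    ∃ v w, v ≠ w ∧ r v < m v ∧ m w < 2 ∧
      onesIn D (transfer m v w) ≤ onesIn A (transfer m v w) ∧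
      exchangeKey A ω m < exchangeKey A ω (transfer m v w) := by
  have hsum0 : ∑ x, ((r x : ℤ) - m x) = 0 := by
    rw [Finset.sum_sub_distrib, hmr, sub_self]
  have hne' : ∃ x, (r x : ℤ) - m x ≠ 0 := by
    by_contra! h
    exact hne (funext fun x => by have := h x; omega)
  have hA : ∀ x, (r x : ℤ) - m x ≠ 0 → A x := fun x hx => by
    by_contra h
    exact hx (by rw [hout x h, sub_self])
  have hD : ∀ v w, A v → A w → v ≠ w → onesIn D (transfer m v w) = onesIn D m := by
    intro v w hv hw hvw
    rw [onesIn_transfer hvw]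
    simp [hAD v hv, hAD w hw]
  -- Changing a 2 and a 0 into two ones raises the second component of the key.
  by_cases hi : (∃ v, r v < m v ∧ m v = 2) ∧ ∃ w, A w ∧ m w = 0
  · obtain ⟨⟨v, hv, hv2⟩, w, hwA, hw0⟩ := hi
    have hvA : A v := hA v (by omega)
    have hvw : v ≠ w := by rintro rfl; omega
    have h2 : onesIn A (transfer m v w) = onesIn A m + 2 := by
      rw [onesIn_transfer hvw]
      simp [hvA, hwA, hv2, hw0]
      ring
    refine ⟨v, w, hvw, hv, by omega, ?_, ?_⟩
    · rw [hD v w hvA hwA hvw, h2]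
      omega
    · rw [exchangeKey_lt_iff, h2, sumIn_transfer hvw (by omega), if_pos hvA, if_pos hwA]
      right
      constructor
      · ring
      · left; omega
  have hdiff : ∑ x, ((if A x ∧ r x = 1 then 1 else 0 : ℤ) - if A x ∧ m x = 1 then 1 else 0) =
      onesIn A r - onesIn A m := Finset.sum_sub_distrib _ _
  -- If `A` contains a zero of `m`, every entry exceeding `r` equals 1 and drops to 0, and `ε = 1`
  -- works; if not, all values of `m` on `A` are 1 or 2 and `ε = -1` works. Since `m` and `r` have
  -- equal totals, summation yields that `r` has at most as many ones on `A` as `m`.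
  have hcases : ∃ ε : ℤ, (ε = 1 ∨ ε = -1) ∧ ∀ x,
      ((if A x ∧ r x = 1 then 1 else 0 : ℤ) - if A x ∧ m x = 1 then 1 else 0) ≤
        ε * ((r x : ℤ) - m x) := by
    by_cases h0 : ∃ w, A w ∧ m w = 0
    · refine ⟨1, Or.inl rfl, fun x => ?_⟩
      have h1 : ∀ v, r v < m v → m v ≠ 2 := fun v hv hv2 => hi ⟨⟨v, hv, hv2⟩, h0⟩
      have := h1 x
      have := hm x
      have := hr x
      by_cases hxA : A x
      · simp only [hxA, true_and]
        split_ifs <;> omega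
      · simp [hxA, hout x hxA]
    · push Not at h0
      refine ⟨-1, Or.inr rfl, fun x => ?_⟩
      have := h0 x
      have := hm x
      have := hr x
      by_cases hxA : A x
      · have := h0 x hxA
        simp only [hxA, true_and]
        split_ifs <;> omega
      · simp [hxA, hout x hxA]
  obtain ⟨ε, hε, hpt⟩ := hcases
  have hεsum : ∑ x, ε * ((r x : ℤ) - m x) = 0 := by rw [← Finset.mul_sum, hsum0, mul_zero]
  have hle := Finset.sum_le_sum fun x (_ : x ∈ Finset.univ) => hpt x
  rw [hεsum, hdiff] at hle
  have honeq : onesIn A m = onesIn A r := by omega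
  -- Equality of the sums forces equality termwise: `m` and `r` differ only by swaps of 0 and 1, or
  -- only by swaps of 1 and 2. A transfer between such places keeps the number of ones, and the
  -- weight decides.
  have heq : ∀ x, ((if A x ∧ r x = 1 then 1 else 0 : ℤ) - if A x ∧ m x = 1 then 1 else 0) =
        ε * ((r x : ℤ) - m x) := by
    have := (Finset.sum_eq_sum_iff_of_le fun x (_ : x ∈ Finset.univ) => hpt x).1
      (by rw [hεsum, hdiff, honeq, sub_self])
    exact fun x => this x (Finset.mem_univ x)
  have hwt : 0 ≤ ∑ x, ω x * ((r x : ℤ) - m x) := by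
    have h1 := hw honeq
    have h2 : weightIn A ω r - weightIn A ω m = ∑ x, ω x * ((r x : ℤ) - m x) := by
      unfold weightIn
      rw [← Finset.sum_sub_distrib]
      refine Finset.sum_congr rfl fun x _ => ?_
      by_cases hxA : A x
      · simp only [hxA, if_true]; ring
      · simp [hxA, hout x hxA]
    omega
  obtain ⟨v, w, hv, hw', hlt⟩ := exists_neg_pos_of_sum_eq_zero _ ω hsum0 hwt hne'
    fun x y hx hy => hω x y (hA x hx) (hA y hy)
  have hvA := hA v hv.ne
  have hwA := hA w hw'.ne'
  have hvw : v ≠ w := by rintro rfl; omega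
  have hrw := hr w
  have hmv := hm v
  have hsame : onesIn A (transfer m v w) = onesIn A m := by
    rw [onesIn_transfer hvw]
    have h1 := heq v
    have h2 := heq w
    simp only [hvA, hwA, true_and] at h1 h2 ⊢
    rcases hε with rfl | rfl <;> split_ifs at h1 h2 ⊢ <;> omega
  refine ⟨v, w, hvw, by omega, by omega, ?_, ?_⟩
  · rw [hD v w hvA hwA hvw, hsame]
    exact hones
  · rw [exchangeKey_lt_iff, hsame, sumIn_transfer hvw (by omega), weightIn_transfer hvw (by omega),
      if_pos hvA, if_pos hwA, if_pos hvA, if_pos hwA]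
    right
    refine ⟨by ring, Or.inr ⟨rfl, by omega⟩⟩

/-- If `m` nowhere exceeds `r` outside `A`, equal totals give `m` at least as large a sum on `A`;
the order of the keys forces equality, so the two functions agree outside `A`. This separates the
two cases above. -/
theorem exists_transfer (hAD : ∀ x, A x → ¬ D x)
    (hω : ∀ x y, A x → A y → ω x = ω y → x = y) {m r : β → ℕ} (hm : ∀ x, m x ≤ 2)
    (hr : ∀ x, r x ≤ 2) (hmr : ∑ x, (m x : ℤ) = ∑ x, (r x : ℤ))
    (hsum : ∑ x, (m x : ℤ) ≤ 2 * ∑ x, if A x then 1 else 0) (hones : onesIn D m ≤ onesIn A m)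
    (hne : r ≠ m) (hkey : exchangeKey A ω m ≤ exchangeKey A ω r) :
    ∃ v w, v ≠ w ∧ r v < m v ∧ m w < 2 ∧
      onesIn D (transfer m v w) ≤ onesIn A (transfer m v w) ∧
      exchangeKey A ω m < exchangeKey A ω (transfer m v w) := by
  by_cases hex : ∃ v, ¬ A v ∧ r v < m v
  · obtain ⟨v, hvA, hv⟩ := hex
    obtain ⟨w, h1, h2, h3, h4⟩ :=
      exists_transfer_of_lt_outside (ω := ω) hAD hm hsum hones hvA (by omega)
    exact ⟨v, w, h1, hv, h2, h3, h4⟩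
  · push Not at hex
    rw [exchangeKey_le_iff] at hkey
    have hnonneg : ∀ x ∈ Finset.univ, 0 ≤ if A x then (0 : ℤ) else r x - m x := by
      intro x _
      split_ifs with h
      · exact le_rfl
      · have := hex x h; omega
    have hs : ∑ x, (if A x then (0 : ℤ) else r x - m x) = sumIn A m - sumIn A r := by
      have : ∀ x, (if A x then (0 : ℤ) else r x - m x) =
          (r x - m x) + ((if A x then (m x : ℤ) else 0) - if A x then (r x : ℤ) else 0) := by
        intro x
        split_ifs <;> ring
      simp only [this, Finset.sum_add_distrib, Finset.sum_sub_distrib, hmr, sumIn]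
      ring
    have hs0 := Finset.sum_nonneg hnonneg
    have hSA : sumIn A m = sumIn A r := by omega
    have hz := (Finset.sum_eq_zero_iff_of_nonneg hnonneg).1 (by rw [hs, hSA, sub_self])
    refine exists_transfer_inside hAD hω hm hr hmr hones hne (fun x hx => ?_) (by omega)
      (by omega)
    have := hz x (Finset.mem_univ x)
    rw [if_neg hx] at this
    omega

end Exchange

end

/-! ### Vertex sets covered by matchings. -/

noncomputable section

open MvPolynomial

section Matchings

variable {V : Type*}

/-- The exponent vector of the squarefree monomial with support `X`. -/
def squarefreeExponent (X : Finset V) : V →₀ ℕ := ∑ v ∈ X, Finsupp.single v 1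

theorem degree_squarefreeExponent (X : Finset V) : (squarefreeExponent X).degree = X.card := by
  simp [squarefreeExponent, map_sum]

theorem monomial_squarefreeExponent (K : Type*) [Field K] (X : Finset V) :
    monomial (squarefreeExponent X) (1 : K) = ∏ v ∈ X, (MvPolynomial.X v : MvPolynomial V K) :=
  monomial_sum_one _ _

variable [DecidableEq V]

/-- `X` is the set of vertices covered by a matching of `G` with `n` edges. -/
inductive MatchCover (G : SimpleGraph V) : ℕ → Finset V → Prop
  | empty : MatchCover G 0 ∅
  | insertEdge {n : ℕ} {X : Finset V} {u v : V} : MatchCover G n X → G.Adj u v → u ∉ X → v ∉ X →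
      MatchCover G (n + 1) (insert u (insert v X))

theorem MatchCover.card_eq {G : SimpleGraph V} {n : ℕ} {X : Finset V} (h : MatchCover G n X) :
    X.card = 2 * n := by
  induction h with
  | empty => simp
  | insertEdge _ hadj hu hv ih =>
    rw [Finset.card_insert_of_notMem, Finset.card_insert_of_notMem hv, ih]
    · ring
    · simp [hu, hadj.ne]

theorem MatchCover.exists_adj {G : SimpleGraph V} {n : ℕ} {X : Finset V} (h : MatchCover G n X)
    {v : V} (hv : v ∈ X) : ∃ w ∈ X, G.Adj v w := by
  induction h with
  | empty => simp at hv
  | @insertEdge n X a b _ hadj ha hb ih =>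
    rw [Finset.mem_insert, Finset.mem_insert] at hv
    rcases hv with rfl | rfl | hv
    · exact ⟨b, by simp, hadj⟩
    · exact ⟨a, by simp, hadj.symm⟩
    · obtain ⟨w, hw, h⟩ := ih hv
      exact ⟨w, by simp [hw], h⟩

theorem MatchCover.exists_matching {G : SimpleGraph V} {n : ℕ} {X : Finset V}
    (h : MatchCover G n X) (K : Type*) [Field K] : ∃ M : Finset (Sym2 V), IsMatchingSet G M ∧
      M.card = n ∧ (∀ v, v ∈ X ↔ ∃ e ∈ M, v ∈ e) ∧
      ∏ e ∈ M, edgeMonomial K e = ∏ v ∈ X, (MvPolynomial.X v : MvPolynomial V K) := by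
  induction h with
  | empty => exact ⟨∅, by simp [IsMatchingSet]⟩
  | @insertEdge n X a b _ hadj ha hb ih =>
    obtain ⟨M, ⟨hM, hM'⟩, hc, hX, hp⟩ := ih
    have hnm : ∀ e ∈ M, a ∉ e ∧ b ∉ e := fun e he =>
      ⟨fun h => ha ((hX a).2 ⟨e, he, h⟩), fun h => hb ((hX b).2 ⟨e, he, h⟩)⟩
    have hne : s(a, b) ∉ M := fun h => (hnm _ h).1 (by simp)
    refine ⟨insert s(a, b) M, ⟨?_, ?_⟩, ?_, ?_, ?_⟩
    · intro e he
      rcases Finset.mem_insert.1 he with rfl | he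
      · exact hadj
      · exact hM e he
    · intro e he f hf hef v hve hvf
      rcases Finset.mem_insert.1 he with rfl | he' <;>
        rcases Finset.mem_insert.1 hf with rfl | hf'
      · exact hef rfl
      · rcases Sym2.mem_iff.1 hve with rfl | rfl
        · exact (hnm f hf').1 hvf
        · exact (hnm f hf').2 hvf
      · rcases Sym2.mem_iff.1 hvf with rfl | rfl
        · exact (hnm e he').1 hve
        · exact (hnm e he').2 hve
      · exact hM' e he' f hf' hef v hve hvf
    · rw [Finset.card_insert_of_notMem hne, hc]
    · intro v
      simp only [Finset.mem_insert, hX, exists_eq_or_imp, Sym2.mem_iff, or_assoc]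
    · rw [Finset.prod_insert hne, Finset.prod_insert, Finset.prod_insert hb, hp, ← mul_assoc]
      · rfl
      · simp [ha, hadj.ne]

theorem IsMatchingSet.exists_matchCover {G : SimpleGraph V} {M : Finset (Sym2 V)}
    (h : IsMatchingSet G M) (K : Type*) [Field K] : ∃ X : Finset V, MatchCover G M.card X ∧
      (∀ v, v ∈ X ↔ ∃ e ∈ M, v ∈ e) ∧
      ∏ e ∈ M, edgeMonomial K e = ∏ v ∈ X, (MvPolynomial.X v : MvPolynomial V K) := by
  induction M using Finset.induction_on with
  | empty => exact ⟨∅, MatchCover.empty, by simp, by simp⟩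
  | @insert e M he ih =>
    obtain ⟨X, hX, hcov, hp⟩ := ih ⟨fun f hf => h.1 f (Finset.mem_insert_of_mem hf),
      fun f hf g hg => h.2 f (Finset.mem_insert_of_mem hf) g (Finset.mem_insert_of_mem hg)⟩
    induction e using Sym2.inductionOn with
    | _ a b =>
    have hadj : G.Adj a b := h.1 _ (Finset.mem_insert_self _ _)
    have hnot : ∀ v ∈ s(a, b), v ∉ X := by
      intro v hv hvX
      obtain ⟨f, hf, hvf⟩ := (hcov v).1 hvX
      exact h.2 _ (Finset.mem_insert_self _ _) f (Finset.mem_insert_of_mem hf)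
        (by rintro rfl; exact he hf) v hv hvf
    have ha : a ∉ X := hnot a (by simp)
    have hb : b ∉ X := hnot b (by simp)
    refine ⟨insert a (insert b X), ?_, ?_, ?_⟩
    · rw [Finset.card_insert_of_notMem he]
      exact hX.insertEdge hadj ha hb
    · intro v
      simp only [Finset.mem_insert, hcov, exists_eq_or_imp, Sym2.mem_iff, or_assoc]
    · rw [Finset.prod_insert he, Finset.prod_insert, Finset.prod_insert hb, hp, ← mul_assoc]
      · rfl
      · simp [ha, hadj.ne]

theorem squarefreeExponent_apply (X : Finset V) (v : V) :
    squarefreeExponent X v = if v ∈ X then 1 else 0 := by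
  simp [squarefreeExponent, Finsupp.finsetSum_apply, Finsupp.single_apply]

/-- The product over a matching depends only on the covered vertices, so matchings with the same
cover give the same generator. -/
theorem squarefreePower_eq_span (K : Type*) [Field K] (G : SimpleGraph V) (k : ℕ) :
    squarefreePower K G k = Ideal.span ((fun X => monomial (squarefreeExponent X) (1 : K)) ''
      {X | MatchCover G k X}) := by
  unfold squarefreePower
  congr 1
  ext f
  constructor
  · rintro ⟨M, hM, rfl, rfl⟩
    obtain ⟨X, hX, -, hp⟩ := hM.exists_matchCover K
    exact ⟨X, hX, by rw [hp, ← monomial_squarefreeExponent]⟩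
  · rintro ⟨X, hX, rfl⟩
    obtain ⟨M, hM, hc, -, hp⟩ := MatchCover.exists_matching hX K
    exact ⟨M, hM, hc, by rw [hp, ← monomial_squarefreeExponent]⟩

end Matchings

/-! ### Encoding covers of a whisker graph by functions, and linear quotients. -/

section Whisker

variable {β : Type*} [Fintype β] {A D : β → Prop} [DecidablePred A] [DecidablePred D]

theorem exists_of_onesIn_pos {m : β → ℕ} (h : 0 < onesIn A m) : ∃ x, A x ∧ m x = 1 := by
  by_contra! hcon
  refine h.ne' (Finset.sum_eq_zero fun x _ => if_neg ?_)
  rintro ⟨h1, h2⟩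
  exact hcon x h1 h2

theorem onesIn_pos {m : β → ℕ} {x : β} (h1 : A x) (h2 : m x = 1) : 0 < onesIn A m :=
  Finset.sum_pos' (fun x _ => by split_ifs <;> norm_num) ⟨x, Finset.mem_univ x, by simp [h1, h2]⟩

theorem onesIn_nonneg (m : β → ℕ) : 0 ≤ onesIn A m :=
  Finset.sum_nonneg fun x _ => by split_ifs <;> norm_num

/-- The set of vertices of a whisker graph described by `m`: the number `m b` says how many of `b`
and its whisker vertex are missing. -/
def stateCover (m : β → ℕ) : Finset (β ⊕ β) :=
  (Finset.univ.filter fun b => m b ≤ 1).disjSum (Finset.univ.filter fun b => m b = 0)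

@[simp] theorem inl_mem_stateCover {m : β → ℕ} {b : β} : Sum.inl b ∈ stateCover m ↔ m b ≤ 1 := by
  simp [stateCover]

@[simp] theorem inr_mem_stateCover {m : β → ℕ} {b : β} : Sum.inr b ∈ stateCover m ↔ m b = 0 := by
  simp [stateCover]

variable [DecidableEq β]

theorem sum_update_eq (m : β → ℕ) (b : β) (n : ℕ) (g : β → ℕ → ℤ) :
    ∑ x, g x (Function.update m b n x) = ∑ x, g x (m x) + (g b n - g b (m b)) := by
  have : ∀ x, g x (Function.update m b n x) = g x (m x) +
      if x = b then g b n - g b (m b) else 0 := by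
    intro x
    by_cases h : x = b
    · subst h; simp
    · simp [h]
  simp [this, Finset.sum_add_distrib]

theorem sum_cast_update (m : β → ℕ) (b : β) (n : ℕ) :
    ∑ x, (Function.update m b n x : ℤ) = ∑ x, (m x : ℤ) + (n - m b) :=
  sum_update_eq m b n fun _ n => (n : ℤ)

theorem onesIn_update (m : β → ℕ) (b : β) (n : ℕ) :
    onesIn A (Function.update m b n) = onesIn A m +
      ((if A b ∧ n = 1 then 1 else 0) - if A b ∧ m b = 1 then 1 else 0) :=
  sum_update_eq m b n fun x n => if A x ∧ n = 1 then 1 else 0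

theorem stateCover_update_zero {m : β → ℕ} {b : β} :
    stateCover (Function.update m b 0) =
      insert (Sum.inl b) (insert (Sum.inr b) (stateCover m)) := by
  ext (x | x) <;> by_cases h : x = b <;> simp [h]

theorem stateCover_update_one {m : β → ℕ} {a b : β} (ha : m a ≠ 0) (hb : m b ≠ 0) :
    stateCover (Function.update (Function.update m a 1) b 1) =
      insert (Sum.inl a) (insert (Sum.inl b) (stateCover m)) := by
  ext (x | x)
  · by_cases h : x = b <;> by_cases h' : x = a <;> simp [h, h', Function.update_apply]
  · by_cases h : x = b <;> by_cases h' : x = a <;> simp [h, h', Function.update_apply, ha, hb]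

variable (A D) in
/-- The functions `m` for which `stateCover m` is covered by a matching with `k` edges. -/
structure IsState (k : ℕ) (m : β → ℕ) : Prop where
  le_two : ∀ x, m x ≤ 2
  sum_eq : ∑ x, (m x : ℤ) + 2 * k = 2 * Fintype.card β
  ones_le : onesIn D m ≤ onesIn A m

/-- The vertices of the graph `B` are of three types: those in `A` are joined to all vertices, those
in `D` are joined to the vertices in `A` only, all others form a clique. -/
structure IsCliqueType (A D : β → Prop) (B : SimpleGraph β) : Prop where
  disj : ∀ x, A x → ¬ D x
  adj_of_mem : ∀ x y, A x → x ≠ y → B.Adj x y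
  adj_of_not_mem : ∀ x y, ¬ D x → ¬ D y → x ≠ y → B.Adj x y
  mem_of_adj : ∀ x y, D x → B.Adj x y → A y

theorem MatchCover.exists_isState {B : SimpleGraph β} (hB : IsCliqueType A D B) {k : ℕ}
    {X : Finset (β ⊕ β)} (h : MatchCover (whiskerGraph B) k X) :
    ∃ m, IsState A D k m ∧ stateCover m = X := by
  induction h with
  | empty =>
    refine ⟨fun _ => 2, ⟨fun _ => le_rfl, by simp [mul_comm], by simp [onesIn]⟩, ?_⟩
    simp [stateCover]
  | @insertEdge n X u v _ hadj hu hv ih =>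
    obtain ⟨m, ⟨h2, hs, ho⟩, rfl⟩ := ih
    have hwhisker : ∀ b, Sum.inl b ∉ stateCover m → ∃ m', IsState A D (n + 1) m' ∧
        stateCover m' = insert (Sum.inl b) (insert (Sum.inr b) (stateCover m)) := by
      intro b hb
      have hmb : m b = 2 := by
        rw [inl_mem_stateCover] at hb
        have := h2 b
        omega
      refine ⟨Function.update m b 0, ⟨fun x => ?_, ?_, ?_⟩, stateCover_update_zero⟩
      · rw [Function.update_apply]
        split_ifs
        · omega
        · exact h2 x
      · rw [sum_cast_update, hmb]
        push_cast
        linarith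
      · rw [onesIn_update, onesIn_update, hmb]
        simpa using ho
    rcases u with a | a <;> rcases v with b | b
    · have hadj' : B.Adj a b := hadj
      rw [inl_mem_stateCover] at hu hv
      have ha := h2 a
      have hb := h2 b
      have ha2 : m a = 2 := by omega
      have hb2 : m b = 2 := by omega
      refine ⟨Function.update (Function.update m a 1) b 1, ⟨fun x => ?_, ?_, ?_⟩,
        stateCover_update_one (by omega) (by omega)⟩
      · simp only [Function.update_apply]
        split_ifs
        · omega
        · omega
        · exact h2 x
      · rw [sum_cast_update, sum_cast_update, Function.update_of_ne hadj'.ne', ha2, hb2]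
        push_cast
        linarith
      · have h1 := hB.mem_of_adj a b
        have h2 := hB.mem_of_adj b a
        have h3 := hB.disj a
        have h4 := hB.disj b
        simp only [onesIn_update, Function.update_of_ne hadj'.ne', ha2, hb2]
        -- An endpoint in `D` forces the other endpoint into `A`, so a base edge adds no more ones
        -- on `D` than on `A`.
        have : (if D a then 1 else 0 : ℤ) + (if D b then 1 else 0) ≤
            (if A a then 1 else 0) + (if A b then 1 else 0) := by
          split_ifs <;> simp_all [hadj'.symm]
        simp
        linarith
    · obtain rfl : a = b := hadj
      exact hwhisker a hu
    · obtain rfl : a = b := hadj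
      rw [Finset.insert_comm]
      exact hwhisker a hv
    · exact hadj.elim

/-- Edges are peeled off: a zero gives a whisker; without zeros, a one in `D` is paired with a one
in `A`; without ones in `D`, any two ones are adjacent. -/
theorem IsState.matchCover {B : SimpleGraph β} (hB : IsCliqueType A D B) {k : ℕ} {m : β → ℕ}
    (h : IsState A D k m) : MatchCover (whiskerGraph B) k (stateCover m) := by
  induction k generalizing m with
  | zero =>
    obtain ⟨h2, hs, -⟩ := h
    have h0 : ∑ x, (2 - m x : ℤ) = 0 := by
      rw [Finset.sum_sub_distrib]
      simp
      push_cast at hs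
      linarith
    have h0' := (Finset.sum_eq_zero_iff_of_nonneg fun x _ => by have := h2 x; omega).1 h0
    have : stateCover m = ∅ := by
      ext (x | x)
      all_goals
        have := h0' x (Finset.mem_univ x)
        simp
        omega
    rw [this]
    exact MatchCover.empty
  | succ k ih =>
    obtain ⟨h2, hs, ho⟩ := h
    have hpair : ∀ a b, B.Adj a b → m a = 1 → m b = 1 →
        onesIn D (Function.update (Function.update m a 2) b 2) ≤
          onesIn A (Function.update (Function.update m a 2) b 2) →
        MatchCover (whiskerGraph B) (k + 1) (stateCover m) := by
      intro a b hab ha hb hle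
      have hst : IsState A D k (Function.update (Function.update m a 2) b 2) := by
        refine ⟨fun x => ?_, ?_, hle⟩
        · simp only [Function.update_apply]
          split_ifs
          · exact le_rfl
          · exact le_rfl
          · exact h2 x
        · rw [sum_cast_update, sum_cast_update, Function.update_of_ne hab.ne', ha, hb]
          push_cast at hs ⊢
          linarith
      have hc := (ih hst).insertEdge (u := Sum.inl a) (v := Sum.inl b) (show B.Adj a b from hab)
        (by simp [hab.ne]) (by simp)
      rw [← stateCover_update_one (by simp [hab.ne]) (by simp)] at hc
      convert hc using 2
      ext x
      by_cases hxb : x = b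
      · simp [hxb, hb]
      · by_cases hxa : x = a
        · subst hxa; simp [hxb, ha]
        · simp [hxa, hxb]
    by_cases hz : ∃ b, m b = 0
    · obtain ⟨b, hb⟩ := hz
      have hst : IsState A D k (Function.update m b 2) := by
        refine ⟨fun x => ?_, ?_, ?_⟩
        · rw [Function.update_apply]
          split_ifs
          · exact le_rfl
          · exact h2 x
        · rw [sum_cast_update, hb]
          push_cast at hs ⊢
          linarith
        · rw [onesIn_update, onesIn_update, hb]
          simpa using ho
      have hc := (ih hst).insertEdge (u := Sum.inl b) (v := Sum.inr b) rfl (by simp) (by simp)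
      rw [← stateCover_update_zero] at hc
      convert hc using 2
      simp [← hb]
    · push Not at hz
      by_cases hd : ∃ d, D d ∧ m d = 1
      · obtain ⟨d, hd, hd1⟩ := hd
        obtain ⟨a, ha, ha1⟩ := exists_of_onesIn_pos (lt_of_lt_of_le (onesIn_pos hd hd1) ho)
        have hne : a ≠ d := by rintro rfl; exact hB.disj a ha hd
        refine hpair a d (hB.adj_of_mem a d ha hne) ha1 hd1 ?_
        have had : ¬ A d := fun h => hB.disj d h hd
        simp only [onesIn_update, Function.update_of_ne hne.symm]
        simp [ha, hd, ha1, hd1, had, hB.disj a ha]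
        linarith
      · push Not at hd
        have hval : ∀ x, m x = 1 ∨ m x = 2 := fun x => by
          have := h2 x
          have := hz x
          omega
        obtain ⟨x, hx⟩ : ∃ x, m x = 1 := by
          by_contra! hcon
          have : ∀ x, (m x : ℤ) = 2 := fun x => by
            have := hval x
            have := hcon x
            omega
          simp [this] at hs
          linarith
        -- A single one among twos would make the total odd.
        obtain ⟨y, hyx, hy⟩ : ∃ y, y ≠ x ∧ m y = 1 := by
          by_contra! hcon
          have : ∀ y, (m y : ℤ) = 2 - if y = x then 1 else 0 := fun y => by
            have h1 := hval y
            have h2 := hcon y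
            split_ifs with h
            · subst h; rw [hx]; norm_num
            · have := h2 h; omega
          simp [this] at hs
          omega
        refine hpair x y (hB.adj_of_not_mem x y (fun h => hd x h hx) (fun h => hd y h hy) hyx.symm)
          hx hy ?_
        have h0 : onesIn D (Function.update (Function.update m x 2) y 2) = 0 := by
          refine Finset.sum_eq_zero fun z _ => if_neg ?_
          rintro ⟨hz, hz1⟩
          simp only [Function.update_apply] at hz1
          split_ifs at hz1 <;> first | omega | exact hd z hz hz1
        rw [h0]
        exact onesIn_nonneg _

/-- The numerical hypothesis says that the `2(|β| - k)` missing vertices fit into the whiskers over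
`A`. -/
theorem hasLinearQuotients_whiskerGraph (K : Type*) [Field K] {B : SimpleGraph β}
    (hB : IsCliqueType A D B) (ω : β → ℤ) (hω : ∀ x y, A x → A y → ω x = ω y → x = y) {k : ℕ}
    (hk : 2 * (Fintype.card β : ℤ) ≤ 2 * k + 2 * ∑ x, if A x then 1 else 0) :
    HasLinearQuotients (squarefreePower K (whiskerGraph B) k) := by
  classical
  let s : Finset (β → ℕ) := (Fintype.piFinset fun _ => Finset.range 3).filter (IsState A D k)
  have hs : ∀ m, m ∈ s ↔ IsState A D k m := by
    intro m
    simp only [s, Finset.mem_filter, Fintype.mem_piFinset, Finset.mem_range, and_iff_right_iff_imp]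
    intro h x
    have := h.le_two x
    omega
  have himg : (fun X => monomial (squarefreeExponent X) (1 : K)) ''
      {X | MatchCover (whiskerGraph B) k X} =
      (fun m => monomial (squarefreeExponent (stateCover m)) (1 : K)) '' (s : Set (β → ℕ)) := by
    ext f
    constructor
    · rintro ⟨X, hX, rfl⟩
      obtain ⟨m, hm, rfl⟩ := MatchCover.exists_isState hB hX
      exact ⟨m, (hs m).2 hm, rfl⟩
    · rintro ⟨m, hm, rfl⟩
      exact ⟨_, ((hs m).1 hm).matchCover hB, rfl⟩
  rw [squarefreePower_eq_span, himg]
  refine hasLinearQuotients_of_key (d := 2 * k) s _ (exchangeKey A ω) ?_ ?_ ?_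
  · intro m hm r hr h
    have hm2 := ((hs m).1 hm).le_two
    have hr2 := ((hs r).1 hr).le_two
    ext x
    have h1 := DFunLike.congr_fun h (Sum.inl x)
    have h2 := DFunLike.congr_fun h (Sum.inr x)
    simp only [squarefreeExponent_apply, inl_mem_stateCover, inr_mem_stateCover] at h1 h2
    have := hm2 x
    have := hr2 x
    split_ifs at h1 h2 <;> omega
  · intro m hm
    rw [degree_squarefreeExponent, (((hs m).1 hm).matchCover hB).card_eq]
  · intro m hm r hr hne hle
    obtain ⟨hm2, hms, hmo⟩ := (hs m).1 hm
    obtain ⟨hr2, hrs, hro⟩ := (hs r).1 hr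
    obtain ⟨v, w, hvw, hv, hw, ho, hlt⟩ := exists_transfer hB.disj hω hm2 hr2 (by linarith)
      (by linarith) hmo hne hle
    -- Lowering the value at `v` restores one vertex there: the base vertex if both were missing,
    -- otherwise the leaf.
    refine ⟨transfer m v w, (hs _).2 ⟨fun x => ?_, ?_, ho⟩, hlt,
      if m v = 2 then Sum.inl v else Sum.inr v, ?_, ?_⟩
    · have := hm2 x
      have := hm2 v
      unfold transfer
      split_ifs <;> omega
    · rw [sum_transfer m hvw fun _ n => (n : ℤ), ← hms]
      push_cast [Nat.cast_sub (show 1 ≤ m v by omega)]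
      ring
    · intro x
      have hv2 := hm2 v
      rw [Finsupp.add_apply, squarefreeExponent_apply, squarefreeExponent_apply,
        Finsupp.single_apply]
      rcases x with x | x
      · simp only [inl_mem_stateCover]
        by_cases hxv : x = v
        · subst hxv
          by_cases h : m x = 2 <;> simp [transfer, h]
          split_ifs <;> omega
        · by_cases hxw : x = w
          · subst hxw
            simp only [transfer, hxv]
            split_ifs <;> omega
          · simp [transfer, hxv, hxw]
      · simp only [inr_mem_stateCover]
        by_cases hxv : x = v
        · subst hxv
          by_cases h : m x = 2 <;> simp [transfer, h]
          split_ifs <;> omega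
        · by_cases hxw : x = w
          · subst hxw
            simp [transfer, hxv]
          · simp [transfer, hxv, hxw]
    · have hv2 := hm2 v
      rw [squarefreeExponent_apply, squarefreeExponent_apply]
      by_cases h : m v = 2
      · simp only [h, if_true, inl_mem_stateCover]
        split_ifs <;> omega
      · simp only [h, if_false, inr_mem_stateCover]
        split_ifs <;> omega

end Whisker

end

/-! ### Obstructions to linear relations. -/

noncomputable section

open MvPolynomial

section Obstruction

variable {σ K : Type*} [Field K]

/-- An obstruction to linear relations: if `v` is the only generator dividing `v * x` and `v * y`,
then a relation that multiplies `v` by `x * y` is not generated by linear relations. -/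
theorem span_linear_ne_syzygies {s : Set (σ →₀ ℕ)} {d : ℕ} (hs : ∀ a ∈ s, a.degree = d)
    {u v w : σ →₀ ℕ} (hu : u ∈ s) (hv : v ∈ s) (huv : u ≠ v) {x y : σ}
    (hw : v + (Finsupp.single x 1 + Finsupp.single y 1) = u + w)
    (hx : ∀ a ∈ s, a ≤ v + Finsupp.single x 1 → a = v)
    (hy : ∀ a ∈ s, a ≤ v + Finsupp.single y 1 → a = v) {e n : ℕ}
    {f : Fin n → MvPolynomial σ K} (hf : ∀ i, (f i).IsHomogeneous e)
    (hspan : Ideal.span (Set.range f) = Ideal.span ((fun a => monomial a (1 : K)) '' s)) :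
    ¬ syzygies f ≤
      Submodule.span (MvPolynomial σ K) {r | r ∈ syzygies f ∧ ∀ i, (r i).IsHomogeneous 1} := by
  classical
  have hmem : ∀ a ∈ s, ∃ c : Fin n → MvPolynomial σ K, ∑ i, c i * f i = monomial a 1 := by
    intro a ha
    have h : monomial a (1 : K) ∈ Ideal.span (Set.range f) :=
      hspan ▸ Ideal.subset_span ⟨a, ha, rfl⟩
    rwa [Ideal.mem_span_range_iff_exists_fun] at h
  have hdeg : ∀ i, ∀ b ∈ (f i).support, ∃ a ∈ s, a ≤ b := fun i =>
    mem_ideal_span_monomial_image.1 (hspan ▸ Ideal.subset_span ⟨i, rfl⟩)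
  obtain ⟨α, hα⟩ := hmem v hv
  obtain ⟨γ, hγ⟩ := hmem u hu
  have heq : ∀ a b : σ →₀ ℕ, a ≤ b → b.degree ≤ a.degree → a = b := by
    intro a b hab hd
    obtain ⟨c, rfl⟩ := exists_add_of_le hab
    rw [map_add] at hd
    have hc : c.degree = 0 := by omega
    rw [Finsupp.degree_eq_zero_iff] at hc
    simp [hc]
  have hhom : ∀ {φ : MvPolynomial σ K} {j : ℕ}, φ.IsHomogeneous j → ∀ b, coeff b φ ≠ 0 →
      b.degree = j := fun h b hb =>
    (DFunLike.congr_fun Finsupp.degree_eq_weight_one b).trans (h hb)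
  have hed : e = d := by
    have h1 : coeff v (∑ i, α i * f i) ≠ 0 := by simp [hα]
    rw [coeff_sum] at h1
    obtain ⟨i, -, hi⟩ := Finset.exists_ne_zero_of_sum_ne_zero h1
    rw [coeff_mul] at hi
    obtain ⟨⟨b, b'⟩, hb, hbb⟩ := Finset.exists_ne_zero_of_sum_ne_zero hi
    have hb' : coeff b' (f i) ≠ 0 := right_ne_zero_of_mul hbb
    obtain ⟨a, ha, hab⟩ := hdeg i b' (mem_support_iff.2 hb')
    have hbv : b' ≤ v := by
      rw [← Finset.HasAntidiagonal.mem_antidiagonal.1 hb]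
      exact le_add_self
    have hav := heq a v (hab.trans hbv) (by rw [hs a ha, hs v hv])
    have : b' = v := le_antisymm hbv (hav ▸ hab)
    rw [← hs v hv, ← this, hhom (hf i) b' hb']
  subst hed
  have hsupp : ∀ i, ∀ b, coeff b (f i) ≠ 0 → b ∈ s := by
    intro i b hb
    obtain ⟨a, ha, hab⟩ := hdeg i b (mem_support_iff.2 hb)
    have := heq a b hab (by rw [hs a ha, hhom (hf i) b hb])
    exact this ▸ ha
  -- `ψ` reads off the coefficient of the generator `v` in a relation, whatever generating system
  -- `f` is used.
  let ψ : (Fin n → MvPolynomial σ K) →ₗ[MvPolynomial σ K] MvPolynomial σ K :=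
    Fintype.linearCombination (MvPolynomial σ K) fun i => C (coeff v (f i))
  have hψ : ∀ r, ψ r = ∑ i, r i * C (coeff v (f i)) := fun r => rfl
  -- Compare coefficients at `v * z` in the relation: the terms of each `f i` lie in `s`, and only
  -- `v` among them divides `v * z`.
  have hcoeff : ∀ z : σ, (∀ a ∈ s, a ≤ v + Finsupp.single z 1 → a = v) →
      ∀ r ∈ syzygies f, coeff (Finsupp.single z 1) (ψ r) = 0 := by
    intro z hz r hr
    have h1 : ∑ i, r i * f i = 0 := hr
    have h2 := congrArg (coeff (v + Finsupp.single z 1)) h1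
    rw [coeff_sum, coeff_zero] at h2
    rw [hψ, coeff_sum, ← h2]
    refine Finset.sum_congr rfl fun i _ => ?_
    rw [mul_comm (r i), coeff_C_mul, mul_comm (coeff v (f i)), coeff_mul,
      Finset.sum_eq_single (Finsupp.single z 1, v)]
    · rintro ⟨b, b'⟩ hb hne
      rw [Finset.HasAntidiagonal.mem_antidiagonal] at hb
      by_contra h
      have hb's := hsupp i b' (right_ne_zero_of_mul h)
      have hb'v := hz b' hb's (by rw [← hb]; exact le_add_self)
      subst hb'v
      refine hne (Prod.ext ?_ rfl)
      simp only at hb ⊢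
      rw [add_comm] at hb
      exact add_left_cancel hb
    · intro h
      exact absurd (Finset.HasAntidiagonal.mem_antidiagonal.2 (add_comm _ _)) h
  let J : Ideal (MvPolynomial σ K) := Ideal.span (X '' ({x, y}ᶜ : Set σ))
  intro hle
  -- On a linear relation `ψ` is a linear form without `x` and `y`, hence in `J`. If such relations
  -- generate, all relations map into `J`.
  have hJ : ∀ r ∈ syzygies f, ψ r ∈ J := by
    have : Submodule.span (MvPolynomial σ K)
        {r | r ∈ syzygies f ∧ ∀ i, (r i).IsHomogeneous 1} ≤ Submodule.comap ψ J := by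
      rw [Submodule.span_le]
      rintro r ⟨hr, hr1⟩
      rw [SetLike.mem_coe, Submodule.mem_comap, mem_ideal_span_X_image]
      intro a ha
      have hψr : (ψ r).IsHomogeneous 1 := by
        rw [hψ]
        exact IsHomogeneous.sum _ _ _ fun i _ => by
          simpa using (hr1 i).mul (isHomogeneous_C σ (coeff v (f i)))
      have ha1 := hhom hψr a (mem_support_iff.1 ha)
      obtain ⟨z, rfl⟩ := (Finsupp.sum_eq_one_iff a).1 ha1
      refine ⟨z, ?_, by simp⟩
      rintro (rfl | rfl)
      · exact mem_support_iff.1 ha (hcoeff _ hx r hr)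
      · exact mem_support_iff.1 ha (hcoeff _ hy r hr)
    exact fun r hr => this (hle hr)
  -- The relation `xy * v = w * u`, written in terms of `f`. Its image under `ψ` contains `xy` with
  -- coefficient 1: `w` does not divide `xy`, as this would force `u = v` by degree.
  let r : Fin n → MvPolynomial σ K :=
    (monomial (Finsupp.single x 1 + Finsupp.single y 1) 1 : MvPolynomial σ K) • α -
      (monomial w 1 : MvPolynomial σ K) • γ
  have hr : r ∈ syzygies f := by
    have hlc : ∀ c : Fin n → MvPolynomial σ K,
        Fintype.linearCombination (MvPolynomial σ K) f c = ∑ i, c i * f i := fun c => rfl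
    rw [syzygies, LinearMap.mem_ker, map_sub, map_smul, map_smul, hlc, hlc, hα, hγ,
      smul_eq_mul, smul_eq_mul, monomial_mul, monomial_mul, add_comm _ v, hw, add_comm w, sub_self]
  have hcoef : coeff (Finsupp.single x 1 + Finsupp.single y 1) (ψ r) = 1 := by
    have hwne : ¬ w ≤ Finsupp.single x 1 + Finsupp.single y 1 := by
      intro hle
      obtain ⟨c, hc⟩ := exists_add_of_le hle
      rw [hc, add_comm w c, ← add_assoc] at hw
      have h1 := add_right_cancel hw
      have h2 : c.degree = 0 := by
        have := congrArg Finsupp.degree h1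
        rw [map_add, hs v hv, hs u hu] at this
        omega
      rw [Finsupp.degree_eq_zero_iff] at h2
      rw [h2, add_zero] at h1
      exact huv h1.symm
    rw [map_sub, map_smul, map_smul, smul_eq_mul, smul_eq_mul, coeff_sub, coeff_monomial_mul',
      coeff_monomial_mul', if_pos le_rfl, if_neg hwne, tsub_self, one_mul, sub_zero, hψ]
    have h1 := congrArg (coeff v) hα
    rw [coeff_monomial, if_pos rfl, coeff_sum] at h1
    rw [coeff_sum, ← h1]
    refine Finset.sum_congr rfl fun i _ => ?_
    rw [mul_comm (α i) (C _), coeff_C_mul, mul_comm (coeff v (f i)), coeff_mul,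
      Finset.sum_eq_single (0, v)]
    · rintro ⟨b, b'⟩ hb hne
      rw [Finset.HasAntidiagonal.mem_antidiagonal] at hb
      by_contra h
      have hb's := hsupp i b' (right_ne_zero_of_mul h)
      have hb'v : b' = v := heq _ _ (by rw [← hb]; exact le_add_self)
        (by rw [hs _ hb's, hs v hv])
      subst hb'v
      exact hne (Prod.ext (by simpa using hb) rfl)
    · intro h
      exact absurd (Finset.HasAntidiagonal.mem_antidiagonal.2 (zero_add _)) h
  obtain ⟨z, hz, hz'⟩ := mem_ideal_span_X_image.1 (hJ r hr)
    (Finsupp.single x 1 + Finsupp.single y 1) (by rw [mem_support_iff, hcoef]; exact one_ne_zero)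
  simp only [Set.mem_compl_iff, Set.mem_insert_iff, Set.mem_singleton_iff, not_or] at hz
  apply hz'
  simp [Ne.symm hz.1, Ne.symm hz.2]

/-- The first syzygies of an ideal with a linear resolution are generated by linear relations. -/
theorem HasLinearResolution.exists_generators {I : Ideal (MvPolynomial σ K)}
    (h : HasLinearResolution I) : ∃ (e n : ℕ) (f : Fin n → MvPolynomial σ K),
      (∀ i, (f i).IsHomogeneous e) ∧ Ideal.span (Set.range f) = I ∧ syzygies f ≤
      Submodule.span (MvPolynomial σ K) {r | r ∈ syzygies f ∧ ∀ i, (r i).IsHomogeneous 1} := by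
  obtain ⟨e, b, f, A, hf, hA, hI, h0, -⟩ := h
  refine ⟨e, b 0, f, hf, hI, ?_⟩
  conv_lhs => rw [← h0]
  rw [Matrix.range_mulVecLin, Submodule.span_le]
  rintro _ ⟨j, rfl⟩
  refine Submodule.subset_span ⟨?_, fun i => hA 0 i j⟩
  rw [← h0, Matrix.range_mulVecLin]
  exact Submodule.subset_span ⟨j, rfl⟩

theorem IsLinearlyRelated.exists_generators {I : Ideal (MvPolynomial σ K)}
    (h : IsLinearlyRelated I) : ∃ (e n : ℕ) (f : Fin n → MvPolynomial σ K),
      (∀ i, (f i).IsHomogeneous e) ∧ Ideal.span (Set.range f) = I ∧ syzygies f ≤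
      Submodule.span (MvPolynomial σ K) {r | r ∈ syzygies f ∧ ∀ i, (r i).IsHomogeneous 1} := by
  obtain ⟨e, n, f, hf, hI, -, hs⟩ := h
  exact ⟨e, n, f, hf, hI, hs.ge⟩

end Obstruction

/-! ### Gaps between whiskers. -/

section Whisker

variable {β : Type*} [DecidableEq β]

/-- The union of the whiskers at the vertices in `T`. -/
def whiskerCover (T : Finset β) : Finset (β ⊕ β) := T.disjSum T

theorem whiskerCover_insert (b : β) (T : Finset β) :
    whiskerCover (insert b T) = insert (Sum.inl b) (insert (Sum.inr b) (whiskerCover T)) := by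
  ext (x | x) <;> simp [whiskerCover]

theorem matchCover_whiskerCover (B : SimpleGraph β) (T : Finset β) :
    MatchCover (whiskerGraph B) T.card (whiskerCover T) := by
  induction T using Finset.induction_on with
  | empty => exact MatchCover.empty
  | insert b T hb ih =>
    rw [Finset.card_insert_of_notMem hb, whiskerCover_insert]
    exact ih.insertEdge rfl (by simp [whiskerCover, hb]) (by simp [whiskerCover, hb])

theorem squarefreeExponent_whiskerCover_insert {b : β} {T : Finset β} (hb : b ∉ T) :
    squarefreeExponent (whiskerCover (insert b T)) = squarefreeExponent (whiskerCover T) +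
      (Finsupp.single (Sum.inl b) 1 + Finsupp.single (Sum.inr b) 1) := by
  rw [whiskerCover_insert, squarefreeExponent, Finset.sum_insert, Finset.sum_insert]
  · rw [squarefreeExponent, ← add_assoc, add_comm]
  · simp [whiskerCover, hb]
  · simp [whiskerCover, hb]

theorem eq_of_squarefreeExponent_le {V : Type*} [DecidableEq V] {Y Z : Finset V} {x : V}
    (h : squarefreeExponent Y ≤ squarefreeExponent Z + Finsupp.single x 1) (hx : x ∉ Y)
    (hc : Y.card = Z.card) : Y = Z := by
  refine Finset.eq_of_subset_of_card_le (fun y hy => ?_) hc.ge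
  have h1 := h y
  have hxy : x ≠ y := by rintro rfl; exact hx hy
  rw [Finsupp.add_apply, squarefreeExponent_apply, squarefreeExponent_apply, if_pos hy,
    Finsupp.single_apply, if_neg hxy] at h1
  by_contra hn
  rw [if_neg hn] at h1
  omega

theorem mem_of_squarefreeExponent_le {V : Type*} [DecidableEq V] {Y Z : Finset V} {x y : V}
    (h : squarefreeExponent Y ≤ squarefreeExponent Z + Finsupp.single x 1) (hy : y ∈ Y)
    (hxy : x ≠ y) : y ∈ Z := by
  have h1 := h y
  rw [Finsupp.add_apply, squarefreeExponent_apply, squarefreeExponent_apply, if_pos hy,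
    Finsupp.single_apply, if_neg hxy] at h1
  by_contra hn
  rw [if_neg hn] at h1
  omega

/-- If the whisker at `d` forms a gap with the whiskers at the vertices of a set `T` of
cardinality `k ≥ 1`, then the `k`-th squarefree power of a whisker graph has nonlinear relations. -/
theorem not_exists_linear_generators (K : Type*) [Field K] (B : SimpleGraph β) {T : Finset β}
    (hT : T.Nonempty) {d : β} (hd : d ∉ T) (hgap : ∀ b ∈ T, ¬ B.Adj d b) :
    ¬ ∃ (e n : ℕ) (f : Fin n → MvPolynomial (β ⊕ β) K),
      (∀ i, (f i).IsHomogeneous e) ∧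
      Ideal.span (Set.range f) = squarefreePower K (whiskerGraph B) T.card ∧ syzygies f ≤
      Submodule.span (MvPolynomial (β ⊕ β) K)
        {r | r ∈ syzygies f ∧ ∀ i, (r i).IsHomogeneous 1} := by
  rintro ⟨e, n, f, hf, hspan, hle⟩
  obtain ⟨z, hz⟩ := hT
  obtain ⟨T₀, hzT₀, rfl⟩ : ∃ T₀, z ∉ T₀ ∧ insert z T₀ = T :=
    ⟨T.erase z, Finset.notMem_erase z T, Finset.insert_erase hz⟩
  have hdT₀ : d ∉ T₀ := fun h => hd (Finset.mem_insert_of_mem h)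
  have hdz : d ≠ z := fun h => hd (h ▸ Finset.mem_insert_self _ _)
  set k := (insert z T₀).card with hk
  have himg : (fun X => monomial (squarefreeExponent X) (1 : K)) ''
      {X | MatchCover (whiskerGraph B) k X} = (fun a => monomial a (1 : K)) ''
        (squarefreeExponent '' {X | MatchCover (whiskerGraph B) k X}) := by
    rw [Set.image_image]
  rw [squarefreePower_eq_span, himg] at hspan
  have hcard : (insert d T₀).card = k := by
    rw [hk, Finset.card_insert_of_notMem hdT₀, Finset.card_insert_of_notMem hzT₀]
  have hXu : whiskerCover (insert d T₀) ∈ {X | MatchCover (whiskerGraph B) k X} := by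
    have := matchCover_whiskerCover B (insert d T₀)
    rwa [hcard] at this
  have hXv : whiskerCover (insert z T₀) ∈ {X | MatchCover (whiskerGraph B) k X} :=
    matchCover_whiskerCover B _
  refine span_linear_ne_syzygies (d := 2 * k) ?_
    (u := squarefreeExponent (whiskerCover (insert d T₀)))
    (v := squarefreeExponent (whiskerCover (insert z T₀)))
    (w := Finsupp.single (Sum.inl z) 1 + Finsupp.single (Sum.inr z) 1)
    (Set.mem_image_of_mem _ hXu)
    (Set.mem_image_of_mem _ hXv) ?_
    (x := Sum.inl d) (y := Sum.inr d) ?_ ?_ ?_ hf hspan hle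
  · rintro _ ⟨X, hX, rfl⟩
    rw [degree_squarefreeExponent, MatchCover.card_eq hX]
  · intro h
    have := DFunLike.congr_fun h (Sum.inl d)
    simp [squarefreeExponent_apply, whiskerCover, hdz, hdT₀] at this
  · rw [squarefreeExponent_whiskerCover_insert hzT₀, squarefreeExponent_whiskerCover_insert hdT₀]
    abel
  · rintro _ ⟨X, hX, rfl⟩ hXle
    congr 1
    refine eq_of_squarefreeExponent_le hXle (fun hdX => ?_)
      (by rw [MatchCover.card_eq hX, (matchCover_whiskerCover B _).card_eq])
    -- A cover containing `d` also contains a neighbour of `d`, which must already lie over `T`; but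
    -- `d` has no neighbour there.
    obtain ⟨y, hy, hadj⟩ := MatchCover.exists_adj hX hdX
    have hyT := mem_of_squarefreeExponent_le hXle hy hadj.ne
    rcases y with y | y
    · exact hgap y (by simpa [whiskerCover] using hyT) hadj
    · obtain rfl : d = y := hadj
      exact hd (by simpa [whiskerCover] using hyT)
  · rintro _ ⟨X, hX, rfl⟩ hXle
    congr 1
    refine eq_of_squarefreeExponent_le hXle (fun hdX => ?_)
      (by rw [MatchCover.card_eq hX, (matchCover_whiskerCover B _).card_eq])
    obtain ⟨y, hy, hadj⟩ := MatchCover.exists_adj hX hdX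
    have hyT := mem_of_squarefreeExponent_le hXle hy hadj.ne
    rcases y with y | y
    · obtain rfl : d = y := hadj
      exact hd (by simpa [whiskerCover] using hyT)
    · exact hadj.elim

end Whisker

end

/-! ### Induced matchings and independent sets. -/

noncomputable section

section InducedMatching

variable {β : Type*} [DecidableEq β]

theorem isInducedMatchingSet_whiskers {B : SimpleGraph β} {T : Finset β}
    (hT : ∀ a ∈ T, ∀ b ∈ T, ¬ B.Adj a b) :
    IsInducedMatchingSet (whiskerGraph B) (T.image fun b => s(Sum.inl b, Sum.inr b)) := by
  refine ⟨⟨?_, ?_⟩, ?_⟩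
  · intro e he
    obtain ⟨b, -, rfl⟩ := Finset.mem_image.1 he
    exact rfl
  · intro e he f hf hne v hve hvf
    obtain ⟨a, -, rfl⟩ := Finset.mem_image.1 he
    obtain ⟨b, -, rfl⟩ := Finset.mem_image.1 hf
    have hab : a ≠ b := by rintro rfl; exact hne rfl
    rw [Sym2.mem_iff] at hve hvf
    rcases hve with rfl | rfl <;> simp [hab] at hvf
  · intro e he hcov
    have hmem : ∀ v ∈ e, Sum.elim id id v ∈ T := by
      intro v hv
      obtain ⟨f, hf, hvf⟩ := hcov v hv
      obtain ⟨b, hb, rfl⟩ := Finset.mem_image.1 hf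
      rw [Sym2.mem_iff] at hvf
      rcases hvf with rfl | rfl <;> exact hb
    induction e using Sym2.inductionOn with
    | _ u v =>
    have hu := hmem u (by simp)
    have hv := hmem v (by simp)
    rcases u with a | a <;> rcases v with b | b
    · exact absurd he (hT a hu b hv)
    · obtain rfl : a = b := he
      exact Finset.mem_image.2 ⟨a, hu, rfl⟩
    · obtain rfl : a = b := he
      exact Finset.mem_image.2 ⟨a, hu, Sym2.eq_swap⟩
    · exact absurd he id

/-- Every edge has a base endpoint; choose one per edge. Two adjacent choices would span an edge
that must belong to the matching and hence equal both edges they came from. -/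
theorem IsInducedMatchingSet.exists_independent {B : SimpleGraph β} {M : Finset (Sym2 (β ⊕ β))}
    (h : IsInducedMatchingSet (whiskerGraph B) M) :
    ∃ T : Finset β, T.card = M.card ∧ ∀ a ∈ T, ∀ b ∈ T, ¬ B.Adj a b := by
  obtain ⟨⟨hM, hdisj⟩, hind⟩ := h
  have hex : ∀ e ∈ M, ∃ b, Sum.inl b ∈ e := by
    intro e he
    have hadj := hM e he
    induction e using Sym2.inductionOn with
    | _ u v =>
    rcases u with a | a
    · exact ⟨a, by simp⟩
    · rcases v with b | b
      · exact ⟨b, by simp⟩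
      · exact absurd hadj id
  choose g hg using hex
  have heq : ∀ e (he : e ∈ M) f (hf : f ∈ M), Sum.inl (g f hf) ∈ e → e = f := by
    intro e he f hf hmem
    by_contra hne
    exact hdisj e he f hf hne _ hmem (hg f hf)
  refine ⟨M.attach.image fun e => g e.1 e.2, ?_, ?_⟩
  · rw [Finset.card_image_of_injective, Finset.card_attach]
    rintro ⟨e, he⟩ ⟨f, hf⟩ hef
    refine Subtype.ext (heq e he f hf ?_)
    simp only at hef
    rw [← hef]
    exact hg e he
  · intro a ha b hb hadj
    obtain ⟨⟨e, he⟩, -, rfl⟩ := Finset.mem_image.1 ha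
    obtain ⟨⟨f, hf⟩, -, rfl⟩ := Finset.mem_image.1 hb
    simp only at hadj
    have hmem : s(Sum.inl (g e he), Sum.inl (g f hf)) ∈ M := by
      refine hind _ (show B.Adj _ _ from hadj) fun v hv => ?_
      rcases Sym2.mem_iff.1 hv with rfl | rfl
      · exact ⟨e, he, hg e he⟩
      · exact ⟨f, hf, hg f hf⟩
    have h1 := heq _ hmem e he (by simp)
    have h2 := heq _ hmem f hf (by simp)
    have hef : e = f := h1.symm.trans h2
    subst hef
    exact hadj.ne rfl

end InducedMatching

/-! ### The graph `G_{p,c,q}` -/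

section PCQ

variable {p c q : ℕ}

/-- The vertices of the base graph of `G_{p,c,q}`. -/
abbrev PCQBase (p c q : ℕ) : Type := Fin (q - c) ⊕ (Fin (c - (p - 1)) ⊕ Fin (p - 1))

/-- The base graph of `G_{p,c,q}`, without the whiskers. -/
def pcqBaseGraph (p c q : ℕ) : SimpleGraph (PCQBase p c q) :=
  graphJoin (⊤ : SimpleGraph (Fin (q - c))) (cliquePlusIsolated p c)

/-- The vertices joined to all other vertices. -/
abbrev IsHub (x : PCQBase p c q) : Prop := x.isLeft = true

/-- The vertices isolated in `H`. -/
abbrev IsIsolated (x : PCQBase p c q) : Prop := Sum.elim (fun _ => false) Sum.isRight x = true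

theorem isCliqueType_pcqBaseGraph :
    IsCliqueType IsHub IsIsolated (pcqBaseGraph p c q) := by
  constructor
  · rintro (x | x | x) <;> simp
  · rintro (x | x | x) (y | y | y) <;> simp [pcqBaseGraph, graphJoin]
  · rintro (x | x | x) (y | y | y) <;> simp [pcqBaseGraph, graphJoin, cliquePlusIsolated]
  · rintro (x | x | x) (y | y | y) <;> simp [pcqBaseGraph, graphJoin, cliquePlusIsolated, IsHub, IsIsolated]

theorem card_pcqBase (hp : 2 ≤ p) (hpc : p ≤ c) (hcq : c ≤ q) :
    Fintype.card (PCQBase p c q) = q := by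
  simp
  omega

theorem hasLinearQuotients_pcqGraph (K : Type*) [Field K] (hp : 2 ≤ p) (hpc : p ≤ c) (hcq : c ≤ q)
    {k : ℕ} (hck : c ≤ k) : HasLinearQuotients (squarefreePower K (pcqGraph p c q) k) := by
  refine hasLinearQuotients_whiskerGraph K (isCliqueType_pcqBaseGraph (p := p) (c := c) (q := q))
    -- Only injectivity on the hubs matters; the weight off the hubs is a default value.
    (Sum.elim (fun a => (a : ℤ)) fun _ => 0) ?_ ?_
  · rintro (x | x) (y | y) <;> simp [Fin.ext_iff]
  · rw [card_pcqBase hp hpc hcq, Fintype.sum_sum_type]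
    simp [IsHub]
    omega

theorem not_exists_linear_generators_pcqGraph (K : Type*) [Field K] (hp : 2 ≤ p) (hpc : p ≤ c)
    {k : ℕ} (hk : 1 ≤ k) (hkc : k < c) :
    ¬ ∃ (e n : ℕ) (f : Fin n → MvPolynomial (PCQVertex p c q) K),
      (∀ i, (f i).IsHomogeneous e) ∧
      Ideal.span (Set.range f) = squarefreePower K (pcqGraph p c q) k ∧ syzygies f ≤
      Submodule.span (MvPolynomial (PCQVertex p c q) K)
        {r | r ∈ syzygies f ∧ ∀ i, (r i).IsHomogeneous 1} := by
  let d : PCQBase p c q := Sum.inr (Sum.inr ⟨0, by omega⟩)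
  let F : Finset (PCQBase p c q) :=
    ((Finset.univ : Finset (Fin (c - (p - 1)) ⊕ Fin (p - 1))).map Function.Embedding.inr).erase d
  -- `H` has `c` vertices and `d` is removed: exactly enough for every `k < c`.
  have hF : F.card = c - 1 := by
    rw [Finset.card_erase_of_mem (by simp [d]), Finset.card_map, Finset.card_univ]
    simp
    omega
  obtain ⟨T, hTF, rfl⟩ := Finset.exists_subset_card_eq (s := F) (n := k) (by omega)
  refine not_exists_linear_generators K (pcqBaseGraph p c q) (Finset.card_pos.1 hk) (d := d)
    (fun h => Finset.notMem_erase _ _ (hTF h)) fun b hb hadj => ?_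
  have hbF := hTF hb
  have := isCliqueType_pcqBaseGraph.mem_of_adj d b rfl hadj
  rcases b with b | b
  · simp [F] at hbF
  · simp [IsHub] at this

theorem matchingNumber_pcqGraph (hp : 2 ≤ p) (hpc : p ≤ c) (hcq : c ≤ q) :
    matchingNumber (pcqGraph p c q) = q := by
  refine IsGreatest.csSup_eq ⟨?_, ?_⟩
  · have h := matchCover_whiskerCover (pcqBaseGraph p c q) Finset.univ
    rw [Finset.card_univ, card_pcqBase hp hpc hcq] at h
    -- Any field would do; the clause about monomials is discarded.
    obtain ⟨M, hM, hc, -⟩ := h.exists_matching ℚ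
    exact ⟨M, hM, hc⟩
  · rintro n ⟨M, hM, rfl⟩
    obtain ⟨X, hX, -⟩ := hM.exists_matchCover ℚ
    have h1 := hX.card_eq
    have h2 := Finset.card_le_univ X
    have h3 : Fintype.card (PCQVertex p c q) = q + q := by
      rw [Fintype.card_sum, card_pcqBase hp hpc hcq]
    omega

theorem inducedMatchingNumber_pcqGraph (hp : 2 ≤ p) (hpc : p ≤ c) :
    inducedMatchingNumber (pcqGraph p c q) = p := by
  have inj : Function.Injective fun d : Fin (p - 1) => (Sum.inr (Sum.inr d) : PCQBase p c q) :=
    Sum.inr_injective.comp Sum.inr_injective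
  let L : Finset (PCQBase p c q) := Finset.univ.map ⟨_, inj⟩
  have hL : L.card = p - 1 := by simp [L]
  have hmemL : ∀ x, x ∈ L ↔ IsIsolated x := by
    rintro (x | x | x) <;> simp [L, IsIsolated]
  have hB := isCliqueType_pcqBaseGraph (p := p) (c := c) (q := q)
  refine IsGreatest.csSup_eq ⟨?_, ?_⟩
  · let z : PCQBase p c q := Sum.inr (Sum.inl ⟨0, by omega⟩)
    have hz : z ∉ L := by simp [hmemL, z]
    refine ⟨_, isInducedMatchingSet_whiskers (T := insert z L) ?_, ?_⟩
    · have hnot : ∀ a ∈ L, ∀ b ∈ insert z L, ¬ (pcqBaseGraph p c q).Adj a b := by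
        intro a ha b hb hadj
        have hhub := hB.mem_of_adj a b ((hmemL a).1 ha) hadj
        rcases Finset.mem_insert.1 hb with rfl | hb
        · simp [z, IsHub] at hhub
        · exact hB.disj b hhub ((hmemL b).1 hb)
      intro a ha b hb hadj
      rcases Finset.mem_insert.1 ha with rfl | ha'
      · rcases Finset.mem_insert.1 hb with rfl | hb'
        · exact hadj.ne rfl
        · exact hnot b hb' _ ha hadj.symm
      · exact hnot a ha' b hb hadj
    · rw [Finset.card_image_of_injective, Finset.card_insert_of_notMem hz, hL]
      · omega
      · intro a b hab
        simpa using hab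
  · rintro n ⟨M, hM, rfl⟩
    obtain ⟨T, hT, hind⟩ := IsInducedMatchingSet.exists_independent (B := pcqBaseGraph p c q) hM
    rw [← hT]
    -- A hub excludes all other vertices; without hubs, at most one vertex lies outside `L`, because
    -- those vertices form a clique.
    by_cases hhub : ∃ a ∈ T, IsHub a
    · obtain ⟨a, ha, hhub⟩ := hhub
      have : Nonempty (PCQBase p c q) := ⟨a⟩
      have : T.card ≤ 1 := Finset.card_le_one_iff_subset_singleton.2 ⟨a, fun b hb => by
        rw [Finset.mem_singleton]
        by_contra hne
        exact hind a ha b hb (hB.adj_of_mem a b hhub (Ne.symm hne))⟩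
      omega
    · have h1 : (T \ L).card ≤ 1 := by
        rw [Finset.card_le_one]
        intro a ha b hb
        rw [Finset.mem_sdiff, hmemL] at ha hb
        by_contra hne
        exact hind a ha.1 b hb.1 (hB.adj_of_not_mem a b ha.2 hb.2 hne)
      have h2 := Finset.card_le_card_sdiff_add_card (s := T) (t := L)
      omega

end PCQ

end

theorem theorem2p4 (K : Type*) [Field K] (p c q : ℕ) (hp : 2 ≤ p) (hpc : p ≤ c) (hcq : c ≤ q) :
    (∀ k : ℕ, c ≤ k → k ≤ q → HasLinearQuotients (squarefreePower K (pcqGraph p c q) k)) ∧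
    (∀ k : ℕ, 1 ≤ k → k < c → ¬ IsLinearlyRelated (squarefreePower K (pcqGraph p c q) k)) ∧
    inducedMatchingNumber (pcqGraph p c q) = p ∧
    matchingNumber (pcqGraph p c q) = q ∧
    linearityIndex K (pcqGraph p c q) = c := by
  refine ⟨fun k hck _ => hasLinearQuotients_pcqGraph K hp hpc hcq hck,
    fun k hk hkc h => not_exists_linear_generators_pcqGraph K hp hpc hk hkc h.exists_generators,
    inducedMatchingNumber_pcqGraph hp hpc, matchingNumber_pcqGraph hp hpc hcq, ?_⟩
  refine IsLeast.csInf_eq ⟨⟨by omega, ?_, ?_⟩, ?_⟩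
  · rw [matchingNumber_pcqGraph hp hpc hcq]
    exact hcq
  · exact (hasLinearQuotients_pcqGraph K hp hpc hcq le_rfl).hasLinearResolution
  · rintro k ⟨hk, -, h⟩
    by_contra! hkc
    exact not_exists_linear_generators_pcqGraph K hp hpc hk hkc h.exists_generators
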